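/- Let $n\ge 2$ and let $\Lambda\subset\mathbb{R}^n$ be a non-Cartesian crystallographic root lattice, that is, up to a similarity of $\mathbb{R}^n$, one of the lattices $\mathcal{A}_n$, $\mathcal{A}_n^*$ ($n\ge 2$), $\mathcal{D}_n$, $\mathcal{D}_n^*$ ($n\ge 3$), $\mathcal{E}_6$, $\mathcal{E}_7$, $\mathcal{E}_8$ (with $n=6,7,8$, respectively), where $^*$ denotes the dual lattice. Let $V=\{x : |x|\le |x-y| \text{ for all } y\in\Lambda\}$ be its Voronoi cell. Let $J\ge 0$, let $s_0,\dots,s_J\in\mathbb{R}^n$, and let $T_j=\{s_j+y+V : y\in\Lambda\}$ be the correspondingly shifted Voronoi tessellations. Assume that $T_0,\dots,T_J$ are pairwise distinct and that the family $\{T_j\}$ is efficient: the intersection of more than two cell facets (a cell facet being a cell of some $T_j$ together with one of its $(n-1)$-dimensional facets, so that a facet shared by two cells counts twice) always has codimension greater than $1$ in $\mathbb{R}^n$. For $m\ge 0$ let $B_m$ be the indicator function of $V$ convolved $m$ times with the indicator function of $V$ (so $B_0=\chi_V$, $B_{m+1}=B_m*\chi_V$), and let $\Phi_m=\{B_m(\cdot-s_j-y)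 : 0\le j\le J,\ y\in\Lambda\}$. Then for no $m\ge 0$ is the family $\Phi_m$ refinable: there are no scale $0<h<1$ and no translation $p\in\mathbb{R}^n$ such that every $f\in\Phi_m$ coincides almost everywhere with a (finite) linear combination with real coefficients of the scaled copies $x\mapsto g\left(h^{-1}(x-p)\right)$, $g\in\Phi_m$. -/

import Mathlib

open MeasureTheory

open scoped Pointwise

namespace VoronoiSpline

noncomputable section

/-! ### Root lattices -/

/-- `Λ` is the `ℤ`-span of a basis of `ℝⁿ` whose Gram matrix is a positive multiple of `G`.
For the Cartan matrix `G` of a simply laced root system this says that `Λ` is, up to a similarity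
of the Euclidean space, the root lattice of that system (the basis being the simple roots). -/
def HasGramMatrix {n : ℕ} {ι : Type} (Λ : Submodule ℤ (EuclideanSpace ℝ (Fin n)))
    (G : Matrix ι ι ℤ) : Prop :=
  ∃ (c : ℝ) (b : Module.Basis ι ℝ (EuclideanSpace ℝ (Fin n))), 0 < c ∧
    Λ = Submodule.span ℤ (Set.range b) ∧ ∀ i j, inner ℝ (b i) (b j) = c * (G i j : ℝ)

/-- The dual lattice: all `x` with `⟪x, y⟫ ∈ ℤ` for every `y ∈ Λ`. -/
def dualLattice {n : ℕ} (Λ : Submodule ℤ (EuclideanSpace ℝ (Fin n))) :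
    Submodule ℤ (EuclideanSpace ℝ (Fin n)) :=
  LinearMap.BilinForm.dualSubmodule (innerₗ (EuclideanSpace ℝ (Fin n))) Λ

/-- The non-Cartesian crystallographic root lattices, up to similarity:
`Aₙ` and `Aₙ*` for `n ≥ 2`, `Dₙ` and `Dₙ*` for `n ≥ 3`, and `E₆`, `E₇`, `E₈`. -/
def IsNonCartesianRootLattice {n : ℕ} (Λ : Submodule ℤ (EuclideanSpace ℝ (Fin n))) : Prop :=
  (2 ≤ n ∧ HasGramMatrix Λ (CartanMatrix.A n)) ∨
  (2 ≤ n ∧ ∃ Λ₀ : Submodule ℤ (EuclideanSpace ℝ (Fin n)),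
    HasGramMatrix Λ₀ (CartanMatrix.A n) ∧ Λ = dualLattice Λ₀) ∨
  (3 ≤ n ∧ HasGramMatrix Λ (CartanMatrix.D n)) ∨
  (3 ≤ n ∧ ∃ Λ₀ : Submodule ℤ (EuclideanSpace ℝ (Fin n)),
    HasGramMatrix Λ₀ (CartanMatrix.D n) ∧ Λ = dualLattice Λ₀) ∨
  HasGramMatrix Λ CartanMatrix.E₆ ∨
  HasGramMatrix Λ CartanMatrix.E₇ ∨
  HasGramMatrix Λ CartanMatrix.E₈

/-! ### Voronoi tessellations and efficient families -/

/-- The Voronoi cell of the lattice point `0`: the points at least as close to `0` as to any other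
lattice point. -/
def voronoiCell {n : ℕ} (Λ : Submodule ℤ (EuclideanSpace ℝ (Fin n))) :
    Set (EuclideanSpace ℝ (Fin n)) :=
  {x | ∀ y ∈ Λ, dist x 0 ≤ dist x y}

/-- The Voronoi tessellation of `Λ`, shifted by `t`, as a set of cells. -/
def tessellation {n : ℕ} (Λ : Submodule ℤ (EuclideanSpace ℝ (Fin n)))
    (t : EuclideanSpace ℝ (Fin n)) : Set (Set (EuclideanSpace ℝ (Fin n))) :=
  {C | ∃ y ∈ Λ, C = (t + y) +ᵥ voronoiCell Λ}

/-- `F` is a facet of the polyhedral cell `C`: a nonempty exposed face of dimension `n - 1`. -/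
def IsFacet {n : ℕ} (C F : Set (EuclideanSpace ℝ (Fin n))) : Prop :=
  F.Nonempty ∧ IsExposed ℝ C F ∧ Module.finrank ℝ (vectorSpan ℝ F) + 1 = n

/-- The cell facets of a family of tessellations: pairs of a cell and one of its facets.
(A facet shared by two adjacent cells gives two cell facets.) -/
def cellFacets {n : ℕ} {ι : Type} (T : ι → Set (Set (EuclideanSpace ℝ (Fin n)))) :
    Set (Set (EuclideanSpace ℝ (Fin n)) × Set (EuclideanSpace ℝ (Fin n))) :=
  {p | (∃ j, p.1 ∈ T j) ∧ IsFacet p.1 p.2}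

/-- A family of tessellations is efficient if the intersection of more than two cell facets
always has codimension greater than one (in particular if it is empty). -/
def IsEfficient {n : ℕ} {ι : Type} (T : ι → Set (Set (EuclideanSpace ℝ (Fin n)))) : Prop :=
  ∀ S ⊆ cellFacets T, 2 < S.encard → (⋂ p ∈ S, p.2).Nonempty →
    Module.finrank ℝ (vectorSpan ℝ (⋂ p ∈ S, p.2)) + 1 < n

/-! ### Splines and refinability -/

/-- The `m`-th spline of the Voronoi cell `V`: the indicator function of `V`, convolved `m` times
with the indicator function of `V`. -/
def cellSpline {n : ℕ} (Λ : Submodule ℤ (EuclideanSpace ℝ (Fin n))) :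
    ℕ → EuclideanSpace ℝ (Fin n) → ℝ
  | 0 => (voronoiCell Λ).indicator 1
  | m + 1 => convolution (cellSpline Λ m) ((voronoiCell Λ).indicator 1)
      (ContinuousLinearMap.lsmul ℝ ℝ) volume

/-- The family of splines over the shifted tessellations: the `m`-th spline of the Voronoi cell,
placed at all points of all the shifted lattices `s j + Λ`. -/
def splineFamily {n : ℕ} {ι : Type} (Λ : Submodule ℤ (EuclideanSpace ℝ (Fin n)))
    (s : ι → EuclideanSpace ℝ (Fin n)) (m : ℕ) : Set (EuclideanSpace ℝ (Fin n) → ℝ) :=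
  {f | ∃ j, ∃ y ∈ Λ, f = fun x => cellSpline Λ m (x - (s j + y))}

/-- The copy of a family of functions under the homothety `x ↦ p + h • x`. -/
def scaledCopy {n : ℕ} (h : ℝ) (p : EuclideanSpace ℝ (Fin n))
    (Φ : Set (EuclideanSpace ℝ (Fin n) → ℝ)) : Set (EuclideanSpace ℝ (Fin n) → ℝ) :=
  {g | ∃ f ∈ Φ, g = fun x => f (h⁻¹ • (x - p))}

/-- A family of functions is refinable if, for some scaled-down copy of the family, every member of
the family is (up to a null set, as cells meet along their facets) a linear combination of members
of the scaled copy. -/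
def IsRefinable {n : ℕ} (Φ : Set (EuclideanSpace ℝ (Fin n) → ℝ)) : Prop :=
  ∃ (h : ℝ) (p : EuclideanSpace ℝ (Fin n)), 0 < h ∧ h < 1 ∧
    ∀ f ∈ Φ, ∃ g ∈ Submodule.span ℝ (scaledCopy h p Φ), f =ᵐ[volume] g

end

end VoronoiSpline

/-!
# Splines of Voronoi cells of root lattices are not refinable

The argument concerns a single Voronoi cell `V`, and rules out refinability for arbitrary shifts.
Put `φ t = ∫_V exp (t ⟪v, x⟫) dx` for a lattice vector `v`. The spline `B_m` is an `(m + 1)`-fold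
convolution power of the indicator function of `V`, and all functions involved are translates of
`B_m` or of a scaled copy of it, so refinability gives `φ t ^ (m + 1) = M t * φ (h t) ^ (m + 1)` for
all real `t`, where `M` is a real exponential sum (`exists_expSum_relation`).

Let `v` be strictly Voronoi-relevant, so that `v / 2` lies in the relative interior of a facet `F`
of `V`. Then `Θ t = t exp (-t |v|² / 2) φ t` has a positive limit `a`, proportional to the area of
`F` (`IsFacetBody.tendsto_mul_setIntegral`, `IsFacetBody.prismMass_pos`). The relation for `Θ`
therefore involves a convergent exponential sum, and such a sum converges exponentially fast
(`abs_sub_le_exp_of_tendsto`). Iterating the relation along `t, t / h, t / h², …` shows that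
`Θ t - a` is bounded above by a multiple of any inverse power of `t`
(`le_limit_add_of_expSum_relation`). On the other hand, `V` contains the prism with the bases `F`
and `F - v`, and if `V` is not contained in the cylinder over `F`, then by convexity the part of `V`
outside the prism contributes at least a multiple of `t ^ (1 - n)` to `Θ t`
(`IsFacetBody.exists_lower_bound`). This is a contradiction.

It remains to see that `V` is not contained in the cylinder over `F`. If `y` is a lattice vector
with `y / 2 ∈ V` and `0 < ⟪v, y⟫ < |v|²`, then the projection of `y / 2` along `v` to the hyperplane
of `F` violates the inequality of `V` that belongs to `y` (`not_isRefinable_of_relevant`). Such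
vectors are exhibited for each lattice. In a root lattice, `v` and `-y` are adjacent simple roots;
in the dual of `A_n`, `v` and `-y` are two of the `n + 1` shortest vectors of an obtuse superbase;
in the dual of `D_n`, `v = (1/2, …, 1/2)` and `y` is a unit vector.
-/

namespace VoronoiSpline

open Filter Topology

variable {n : ℕ}

local notation "𝔼" => EuclideanSpace ℝ (Fin n)

/-! ### Exponential sums -/

/-- The space of real exponential sums `t ↦ ∑ cᵢ exp (aᵢ t)`. -/
def expSums : Submodule ℝ (ℝ → ℝ) :=
  Submodule.span ℝ (Set.range fun a : ℝ => fun t : ℝ => Real.exp (a * t))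

/-- A nonzero exponential sum is asymptotic to its leading term, up to an exponentially small
relative error. -/
theorem exists_leading_term_sum (S : Finset ℝ) (c : ℝ → ℝ) :
    (∀ t : ℝ, ∑ a ∈ S, c a * Real.exp (a * t) = 0) ∨
    ∃ a k C ε : ℝ, k ≠ 0 ∧ 0 < ε ∧ ∀ t : ℝ, 0 ≤ t →
      |(∑ b ∈ S, c b * Real.exp (b * t)) * Real.exp (-a * t) - k| ≤ C * Real.exp (-ε * t) := by
  induction S using Finset.induction_on_max with
  | empty => left; simp
  | insert a S hS ih =>
    have ha : a ∉ S := fun h => (hS a h).false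
    simp only [Finset.sum_insert ha]
    by_cases hc : c a = 0
    · simpa [hc] using ih
    right
    obtain ⟨ε, hε, hεS⟩ : ∃ ε > 0, ∀ b ∈ S, b - a ≤ -ε := by
      rcases S.eq_empty_or_nonempty with rfl | hne
      · exact ⟨1, one_pos, by simp⟩
      · refine ⟨a - S.max' hne, sub_pos.2 (hS _ (S.max'_mem hne)), fun b hb => ?_⟩
        have := S.le_max' b hb
        linarith
    refine ⟨a, c a, ∑ b ∈ S, |c b|, ε, hc, hε, fun t ht => ?_⟩
    have h1 : (c a * Real.exp (a * t) + ∑ b ∈ S, c b * Real.exp (b * t)) * Real.exp (-a * t) - c a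
        = ∑ b ∈ S, c b * Real.exp ((b - a) * t) := by
      have h0 : Real.exp (a * t) * Real.exp (-a * t) = 1 := by
        rw [← Real.exp_add]; simp
      rw [add_mul, mul_assoc, h0, mul_one, add_sub_cancel_left, Finset.sum_mul]
      refine Finset.sum_congr rfl fun b _ => ?_
      rw [mul_assoc, ← Real.exp_add]
      ring_nf
    rw [h1, Finset.sum_mul]
    refine (Finset.abs_sum_le_sum_abs _ _).trans (Finset.sum_le_sum fun b hb => ?_)
    rw [abs_mul, Real.abs_exp]
    gcongr
    exact hεS b hb

theorem exists_leading_term {M : ℝ → ℝ} (hM : M ∈ expSums) :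
    M = 0 ∨ ∃ a k C ε : ℝ, k ≠ 0 ∧ 0 < ε ∧ ∀ t : ℝ, 0 ≤ t →
      |M t * Real.exp (-a * t) - k| ≤ C * Real.exp (-ε * t) := by
  obtain ⟨c, rfl⟩ := (Finsupp.mem_span_range_iff_exists_finsupp).1 hM
  have h : ∀ t, (c.sum fun i a => a • fun t : ℝ => Real.exp (i * t)) t =
      ∑ a ∈ c.support, c a * Real.exp (a * t) := fun t => by
    simp [Finsupp.sum, Finset.sum_apply]
  rcases exists_leading_term_sum c.support c with h0 | h1
  · left; ext t; rw [h, h0]; rfl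
  · right; simpa only [h] using h1

theorem tendsto_const_mul_exp_neg (C : ℝ) {ε : ℝ} (hε : 0 < ε) :
    Tendsto (fun t : ℝ => C * Real.exp (-ε * t)) atTop (𝓝 0) := by
  have : Tendsto (fun t : ℝ => Real.exp (-ε * t)) atTop (𝓝 0) :=
    Real.tendsto_exp_atBot.comp ((tendsto_const_mul_atBot_of_neg (by linarith)).2 tendsto_id)
  simpa using this.const_mul C

/-- An exponential sum with a nonzero limit at infinity converges to it exponentially fast. -/
theorem abs_sub_le_exp_of_tendsto {M : ℝ → ℝ} (hM : M ∈ expSums) {L : ℝ} (hL : L ≠ 0)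
    (hlim : Tendsto M atTop (𝓝 L)) :
    ∃ C ε : ℝ, 0 < ε ∧ ∀ t : ℝ, 0 ≤ t → |M t - L| ≤ C * Real.exp (-ε * t) := by
  rcases exists_leading_term hM with rfl | ⟨a, k, C, ε, hk, hε, hb⟩
  · exact absurd (tendsto_nhds_unique hlim tendsto_const_nhds) hL
  have h1 : Tendsto (fun t => M t * Real.exp (-a * t)) atTop (𝓝 k) := by
    rw [← tendsto_sub_nhds_zero_iff]
    refine squeeze_zero_norm' ?_ (tendsto_const_mul_exp_neg C hε)
    filter_upwards [eventually_ge_atTop 0] with t ht using hb t ht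
  -- Dividing the two limits shows that the leading exponent vanishes.
  have h2 : Tendsto (fun t => Real.exp (-a * t)) atTop (𝓝 (k / L)) := by
    refine (h1.div hlim hL).congr' ?_
    filter_upwards [hlim.eventually_ne hL] with t ht
    simp only [Pi.div_apply]
    field_simp
  have ha : a = 0 := by
    rcases lt_trichotomy a 0 with h | h | h
    · have : Tendsto (fun t => Real.exp (-a * t)) atTop atTop :=
        Real.tendsto_exp_atTop.comp ((tendsto_const_mul_atTop_of_pos (by linarith)).2 tendsto_id)
      exact absurd h2 (not_tendsto_nhds_of_tendsto_atTop this _)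
    · exact h
    · have := tendsto_const_mul_exp_neg 1 h
      simp only [one_mul] at this
      exact absurd (tendsto_nhds_unique h2 this) (div_ne_zero hk hL)
  subst ha
  simp only [neg_zero, zero_mul, Real.exp_zero, mul_one] at h1 hb
  obtain rfl := tendsto_nhds_unique hlim h1
  exact ⟨C, ε, hε, hb⟩

/-! ### The scaling relation in one variable -/

/-- If `X` has the limit `L` and `X (h t)` exceeds `X t` by at most `C / t ^ k`, then `X t` exceeds
`L` by at most a multiple of `t ^ (-k)`: after subtraction of a suitable multiple of `t ^ (-k)`, the
function `X` increases along the sequences `t, t / h, t / h², …`. -/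
theorem le_limit_add_of_scaling {X : ℝ → ℝ} {L h C t₀ : ℝ} (h0 : 0 < h) (h1 : h < 1)
    (ht₀ : 0 < t₀) (hC : 0 ≤ C) (hlim : Tendsto X atTop (𝓝 L)) {k : ℕ} (hk : k ≠ 0)
    (hX : ∀ t, t₀ ≤ t → X (h * t) ≤ X t + C / t ^ k) :
    ∃ D, 0 ≤ D ∧ ∀ t, t₀ ≤ t → X t ≤ L + D / t ^ k := by
  have hhk : h ^ k < 1 := pow_lt_one₀ h0.le h1 hk
  have hpos : 0 < 1 - h ^ k := by linarith
  refine ⟨C * h ^ k / (1 - h ^ k), by positivity, fun t ht => ?_⟩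
  set D := C * h ^ k / (1 - h ^ k) with hD
  have hDeq : D * (1 - h ^ k) = C * h ^ k := by rw [hD]; field_simp
  let u : ℕ → ℝ := fun j => t / h ^ j
  have htpos : 0 < t := ht₀.trans_le ht
  have hu : ∀ j, t₀ ≤ u j := fun j => ht.trans <| by
    rw [le_div_iff₀ (by positivity)]
    exact mul_le_of_le_one_right htpos.le (pow_le_one₀ h0.le h1.le)
  have hmono : Monotone fun j => X (u j) - D / u j ^ k := by
    refine monotone_nat_of_le_succ fun j => ?_
    have hstep := hX (u (j + 1)) (hu _)
    have e1 : h * u (j + 1) = u j := by simp only [u, pow_succ]; field_simp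
    have hup : 0 < u (j + 1) := ht₀.trans_le (hu _)
    rw [e1] at hstep
    have e2 : D / u j ^ k = (D + C) / u (j + 1) ^ k := by
      have : D = (D + C) * h ^ k := by linear_combination hDeq
      rw [← e1, mul_pow]
      nth_rewrite 1 [this]
      field_simp
    rw [e2, add_div]
    linarith
  have hutop : Tendsto u atTop atTop := by
    have : Tendsto (fun j : ℕ => t * (h⁻¹) ^ j) atTop atTop :=
      (tendsto_pow_atTop_atTop_of_one_lt (one_lt_inv_iff₀.2 ⟨h0, h1⟩)).const_mul_atTop htpos
    exact this.congr fun j => by simp only [u, inv_pow, div_eq_mul_inv]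
  have hl : Tendsto (fun j => X (u j) - D / u j ^ k) atTop (𝓝 (L - 0)) :=
    (hlim.comp hutop).sub
      (tendsto_const_nhds.div_atTop ((tendsto_pow_atTop hk).comp hutop))
  have := hmono.ge_of_tendsto hl 0
  simp only [u, pow_zero, div_one, sub_zero] at this
  linarith

/-- A function with a positive limit at infinity, whose power satisfies a two-scale relation with an
exponential sum as a multiplier, exceeds its limit by less than any inverse power. -/
theorem le_limit_add_of_expSum_relation {Θ M : ℝ → ℝ} {a h : ℝ} (h0 : 0 < h) (h1 : h < 1)
    (ha : 0 < a) (hlim : Tendsto Θ atTop (𝓝 a)) (hM : M ∈ expSums) (m : ℕ)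
    (hrel : ∀ t, 0 < t → Θ t ^ (m + 1) = M t * Θ (h * t) ^ (m + 1)) {k : ℕ} (hk : k ≠ 0) :
    ∃ D, ∀ᶠ t in atTop, Θ t ≤ a + D / t ^ k := by
  set X : ℝ → ℝ := fun t => Θ t ^ (m + 1) with hXdef
  have hXlim : Tendsto X atTop (𝓝 (a ^ (m + 1))) := hlim.pow _
  have hscale : Tendsto (fun t : ℝ => h * t) atTop atTop :=
    (tendsto_const_mul_atTop_of_pos h0).2 tendsto_id
  have hXh : Tendsto (fun t => X (h * t)) atTop (𝓝 (a ^ (m + 1))) := hXlim.comp hscale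
  have hapos : 0 < a ^ (m + 1) := by positivity
  have hM1 : Tendsto M atTop (𝓝 1) := by
    have := hXlim.div hXh hapos.ne'
    rw [div_self hapos.ne'] at this
    refine this.congr' ?_
    filter_upwards [hXh.eventually_ne hapos.ne', eventually_gt_atTop 0] with t ht ht0
    simp only [Pi.div_apply]
    rw [div_eq_iff ht]
    exact hrel t ht0
  obtain ⟨C, ε, hε, hb⟩ := abs_sub_le_exp_of_tendsto hM one_ne_zero hM1
  -- Exponential convergence is faster than the required inverse power.
  have hsmall : Tendsto (fun t : ℝ => t ^ k * (C * Real.exp (-ε * t))) atTop (𝓝 0) := by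
    have := (Real.tendsto_pow_mul_exp_neg_atTop_nhds_zero k).comp
      ((tendsto_const_mul_atTop_of_pos hε).2 tendsto_id)
    have := this.const_mul (C / ε ^ k)
    rw [mul_zero] at this
    refine this.congr fun t => ?_
    simp only [Function.comp_apply, id, mul_pow, neg_mul]
    field_simp
  obtain ⟨t₁, ht₁⟩ := eventually_atTop.1 ((hsmall.eventually_le_const one_pos).and
    (((hXh.eventually_le_const (lt_add_one _)).and
      (hXh.eventually_const_le hapos)).and (eventually_gt_atTop 0)))
  have hX : ∀ t, max t₁ 1 ≤ t → X (h * t) ≤ X t + (a ^ (m + 1) + 1) / t ^ k := by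
    intro t ht
    obtain ⟨hs, ⟨hu, hl⟩, htpos⟩ := ht₁ t ((le_max_left _ _).trans ht)
    have hM' : 1 - M t ≤ 1 / t ^ k := by
      have := (abs_le.1 (hb t htpos.le)).1
      have : C * Real.exp (-ε * t) ≤ 1 / t ^ k := by
        rw [le_div_iff₀ (by positivity)]; linarith
      linarith
    have e : X t = M t * X (h * t) := hrel t htpos
    have : (1 - M t) * X (h * t) ≤ 1 / t ^ k * (a ^ (m + 1) + 1) :=
      (mul_le_mul_of_nonneg_right hM' hl).trans (by gcongr)
    rw [e]
    rw [one_div_mul_eq_div] at this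
    linarith
  obtain ⟨D, hD, hle⟩ := le_limit_add_of_scaling h0 h1 (by positivity) (by positivity) hXlim hk hX
  refine ⟨D / a ^ m, ?_⟩
  filter_upwards [eventually_ge_atTop (max t₁ 1)] with t ht
  have htpos : 0 < t := lt_of_lt_of_le (by positivity) ht
  by_cases hΘ : Θ t ≤ a
  · have : 0 ≤ D / a ^ m / t ^ k := by positivity
    linarith
  push Not at hΘ
  have hpow : a ^ m * Θ t ≤ Θ t ^ (m + 1) := by
    rw [pow_succ]
    gcongr
    exact ha.trans hΘ |>.le
  have := hpow.trans (hle t ht)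
  have e : a ^ (m + 1) + D / t ^ k = a ^ m * (a + D / a ^ m / t ^ k) := by
    field_simp
    ring
  rw [e] at this
  exact le_of_mul_le_mul_left this (by positivity)

/-! ### Exponential moments of splines -/

/-- The function `f` weighted by the exponential of the linear form `⟪w, ·⟫`. -/
noncomputable def expWeight {n : ℕ} (w : EuclideanSpace ℝ (Fin n))
    (f : EuclideanSpace ℝ (Fin n) → ℝ) : EuclideanSpace ℝ (Fin n) → ℝ :=
  fun x => f x * Real.exp (inner ℝ w x)

/-- The exponential moment function `w ↦ ∫ exp ⟪w, x⟫ dx` of a set. -/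
noncomputable def expMoment {n : ℕ} (V : Set (EuclideanSpace ℝ (Fin n)))
    (w : EuclideanSpace ℝ (Fin n)) : ℝ :=
  ∫ x, expWeight w (V.indicator 1) x

theorem expWeight_indicator (V : Set 𝔼) (w : 𝔼) :
    expWeight w (V.indicator 1) = V.indicator fun x => Real.exp (inner ℝ w x) := by
  ext x
  by_cases hx : x ∈ V <;> simp [expWeight, hx]

theorem integrableOn_exp_inner {V : Set 𝔼} (hb : Bornology.IsBounded V) (w : 𝔼) :
    IntegrableOn (fun x => Real.exp (inner ℝ w x)) V := by
  have : Continuous fun x : 𝔼 => Real.exp (inner ℝ w x) := by fun_prop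
  exact (this.continuousOn.integrableOn_compact hb.isCompact_closure).mono_set subset_closure

theorem integrable_expWeight_indicator {V : Set 𝔼} (hm : MeasurableSet V)
    (hb : Bornology.IsBounded V) (w : 𝔼) : Integrable (expWeight w (V.indicator 1)) := by
  rw [expWeight_indicator, integrable_indicator_iff hm]
  exact integrableOn_exp_inner hb w

/-- Exponential weights are multiplicative for convolution. -/
theorem expWeight_convolution (w : 𝔼) (f g : 𝔼 → ℝ) :
    expWeight w (convolution f g (ContinuousLinearMap.lsmul ℝ ℝ) volume) =
      convolution (expWeight w f) (expWeight w g) (ContinuousLinearMap.lsmul ℝ ℝ) volume := by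
  ext x
  simp only [expWeight, convolution_lsmul, smul_eq_mul]
  rw [← integral_mul_const]
  congr 1
  ext y
  have : Real.exp (inner ℝ w x) = Real.exp (inner ℝ w y) * Real.exp (inner ℝ w (x - y)) := by
    rw [← Real.exp_add, inner_sub_right]; ring_nf
  rw [this]
  ring

/-- The exponential moments of the splines are the powers of those of the cell. -/
theorem expWeight_cellSpline {Λ : Submodule ℤ 𝔼} (hm : MeasurableSet (voronoiCell Λ))
    (hb : Bornology.IsBounded (voronoiCell Λ)) (w : 𝔼) (m : ℕ) :
    Integrable (expWeight w (cellSpline Λ m)) ∧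
      ∫ x, expWeight w (cellSpline Λ m) x = expMoment (voronoiCell Λ) w ^ (m + 1) := by
  have h0 := integrable_expWeight_indicator hm hb w
  induction m with
  | zero => exact ⟨h0, by simp [cellSpline, expMoment]⟩
  | succ m ih =>
    simp only [cellSpline, expWeight_convolution]
    refine ⟨ih.1.integrable_convolution _ h0, ?_⟩
    rw [integral_convolution _ ih.1 h0, ih.2, pow_succ _ (m + 1)]
    rfl

theorem expWeight_comp_sub (w a : 𝔼) (f : 𝔼 → ℝ) :
    expWeight w (fun x => f (x - a)) =
      fun x => Real.exp (inner ℝ w a) * expWeight w f (x - a) := by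
  ext x
  simp only [expWeight]
  rw [mul_left_comm, ← Real.exp_add, ← inner_add_right]
  simp

theorem expWeight_comp_smul {h : ℝ} (h0 : 0 < h) (w p : 𝔼) (f : 𝔼 → ℝ) :
    expWeight w (fun x => f (h⁻¹ • (x - p))) =
      fun x => Real.exp (inner ℝ w p) * expWeight (h • w) f (h⁻¹ • (x - p)) := by
  ext x
  simp only [expWeight]
  rw [mul_left_comm, ← Real.exp_add, inner_smul_left, inner_smul_right, ← mul_assoc]
  simp only [conj_trivial, mul_inv_cancel₀ h0.ne', one_mul]
  rw [← inner_add_right]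
  simp

theorem integral_comp_homothety {h : ℝ} (h0 : 0 < h) (p : 𝔼) (f : 𝔼 → ℝ) :
    ∫ x, f (h⁻¹ • (x - p)) = h ^ n * ∫ x, f x := by
  rw [integral_sub_right_eq_self (fun x => f (h⁻¹ • x)) p,
    Measure.integral_comp_inv_smul_of_nonneg _ _ h0.le]
  simp

theorem integrable_comp_homothety {h : ℝ} (h0 : 0 < h) (p : 𝔼) {f : 𝔼 → ℝ} (hf : Integrable f) :
    Integrable fun x => f (h⁻¹ • (x - p)) :=
  (hf.comp_smul (inv_ne_zero h0.ne')).comp_sub_right p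

theorem expSums_exp (a : ℝ) : (fun t : ℝ => Real.exp (a * t)) ∈ expSums :=
  Submodule.subset_span ⟨a, rfl⟩

theorem exp_mul_mem_expSums {M : ℝ → ℝ} (hM : M ∈ expSums) (a : ℝ) :
    (fun t => Real.exp (a * t) * M t) ∈ expSums := by
  induction hM using Submodule.span_induction with
  | mem x hx =>
    obtain ⟨b, rfl⟩ := hx
    convert expSums_exp (a + b) using 2 with t
    rw [← Real.exp_add]; ring_nf
  | zero =>
    convert expSums.zero_mem using 1
    ext t; simp
  | add x y _ _ hx hy =>
    convert expSums.add_mem hx hy using 1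
    ext t; simp [mul_add]
  | smul c x _ hx =>
    convert expSums.smul_mem c hx using 1
    ext t; simp only [Pi.smul_apply, smul_eq_mul]; ring

/-- Along a line of frequencies, the exponential moments of a linear combination of the scaled
splines are those of the scaled cell times an exponential sum. -/
theorem exists_expSum_of_mem_span {ι : Type} {Λ : Submodule ℤ 𝔼}
    (hm : MeasurableSet (voronoiCell Λ)) (hb : Bornology.IsBounded (voronoiCell Λ))
    (s : ι → 𝔼) (m : ℕ) {h : ℝ} (h0 : 0 < h) (p v : 𝔼) {g : 𝔼 → ℝ}
    (hg : g ∈ Submodule.span ℝ (scaledCopy h p (splineFamily Λ s m))) :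
    ∃ M ∈ expSums, ∀ t : ℝ, Integrable (expWeight (t • v) g) ∧
      ∫ x, expWeight (t • v) g x =
        M t * expMoment (voronoiCell Λ) ((h * t) • v) ^ (m + 1) := by
  induction hg using Submodule.span_induction with
  | mem g hg =>
    obtain ⟨f, ⟨j, y, -, rfl⟩, rfl⟩ := hg
    refine ⟨fun t => h ^ n * Real.exp ((inner ℝ v p + h * inner ℝ v (s j + y)) * t),
      expSums.smul_mem (h ^ n) (expSums_exp _), fun t => ?_⟩
    obtain ⟨hi, he⟩ := expWeight_cellSpline hm hb ((h * t) • v) m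
    rw [expWeight_comp_smul h0 _ _ fun x => cellSpline Λ m (x - (s j + y)), expWeight_comp_sub,
      smul_smul]
    refine ⟨(integrable_comp_homothety h0 p ((hi.comp_sub_right _).const_mul _)).const_mul _, ?_⟩
    rw [integral_const_mul, integral_comp_homothety h0 p
      fun x => Real.exp (inner ℝ ((h * t) • v) (s j + y)) *
        expWeight ((h * t) • v) (cellSpline Λ m) (x - (s j + y)), integral_const_mul,
      integral_sub_right_eq_self (expWeight ((h * t) • v) (cellSpline Λ m)), he]
    have e : Real.exp ((inner ℝ v p + h * inner ℝ v (s j + y)) * t) =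
        Real.exp (inner ℝ (t • v) p) * Real.exp (inner ℝ ((h * t) • v) (s j + y)) := by
      rw [← Real.exp_add]
      simp only [inner_smul_left, conj_trivial]
      ring_nf
    simp only [e]
    ring
  | zero =>
    have e : ∀ w : 𝔼, expWeight w 0 = 0 := fun w => by ext x; simp [expWeight]
    exact ⟨0, expSums.zero_mem, fun t => by
      rw [e]; exact ⟨integrable_zero _ _ _, by simp⟩⟩
  | add f g _ _ hf hg =>
    obtain ⟨M, hM, h1⟩ := hf
    obtain ⟨N, hN, h2⟩ := hg
    refine ⟨M + N, expSums.add_mem hM hN, fun t => ?_⟩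
    have e : expWeight (t • v) (f + g) =
        fun x => expWeight (t • v) f x + expWeight (t • v) g x := by
      ext x; simp [expWeight, add_mul]
    rw [e]
    refine ⟨(h1 t).1.add (h2 t).1, ?_⟩
    rw [integral_add (h1 t).1 (h2 t).1, (h1 t).2, (h2 t).2, Pi.add_apply, add_mul]
  | smul c f _ hf =>
    obtain ⟨M, hM, h1⟩ := hf
    refine ⟨c • M, expSums.smul_mem c hM, fun t => ?_⟩
    have e : expWeight (t • v) (c • f) = fun x => c * expWeight (t • v) f x := by
      ext x; simp [expWeight, mul_assoc]
    rw [e]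
    refine ⟨(h1 t).1.const_mul _, ?_⟩
    rw [integral_const_mul, (h1 t).2, Pi.smul_apply, smul_eq_mul, mul_assoc]

/-- Refinability turns into a two-scale relation for the exponential moments of the cell, whose
multiplier is an exponential sum along every line. -/
theorem exists_expSum_relation {ι : Type} [Nonempty ι] {Λ : Submodule ℤ 𝔼}
    (hm : MeasurableSet (voronoiCell Λ)) (hb : Bornology.IsBounded (voronoiCell Λ))
    (s : ι → 𝔼) (m : ℕ) (href : IsRefinable (splineFamily Λ s m)) (v : 𝔼) :
    ∃ h : ℝ, 0 < h ∧ h < 1 ∧ ∃ M ∈ expSums, ∀ t : ℝ,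
      expMoment (voronoiCell Λ) (t • v) ^ (m + 1) =
        M t * expMoment (voronoiCell Λ) ((h * t) • v) ^ (m + 1) := by
  obtain ⟨h, p, h0, h1, H⟩ := href
  obtain ⟨j⟩ := ‹Nonempty ι›
  obtain ⟨g, hg, hfg⟩ := H _ ⟨j, 0, Λ.zero_mem, rfl⟩
  obtain ⟨M, hM, hMt⟩ := exists_expSum_of_mem_span hm hb s m h0 p v hg
  refine ⟨h, h0, h1, _, exp_mul_mem_expSums hM (-inner ℝ v (s j + 0)), fun t => ?_⟩
  have e : ∫ x, expWeight (t • v) (fun x => cellSpline Λ m (x - (s j + 0))) x =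
      ∫ x, expWeight (t • v) g x := by
    refine integral_congr_ae ?_
    filter_upwards [hfg] with x hx
    simp only [expWeight, hx]
  rw [(hMt t).2, expWeight_comp_sub, integral_const_mul,
    integral_sub_right_eq_self (expWeight (t • v) (cellSpline Λ m)),
    (expWeight_cellSpline hm hb _ m).2] at e
  rw [mul_assoc, ← e, ← mul_assoc, ← Real.exp_add, inner_smul_left]
  simp only [conj_trivial]
  ring_nf
  simp

/-! ### Scaling along an axis -/

/-- The linear map that multiplies the component along `v` by `σ` and fixes the orthogonal
complement of `v`; for `σ = 0` it is the orthogonal projection along `v`. -/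
noncomputable def axisScale {n : ℕ} (v : EuclideanSpace ℝ (Fin n)) (σ : ℝ) :
    EuclideanSpace ℝ (Fin n) →ₗ[ℝ] EuclideanSpace ℝ (Fin n) :=
  LinearMap.transvection (((σ - 1) / ‖v‖ ^ 2) • innerₗ (EuclideanSpace ℝ (Fin n)) v) v

theorem axisScale_apply (v : 𝔼) (σ : ℝ) (x : 𝔼) :
    axisScale v σ x = x + ((σ - 1) / ‖v‖ ^ 2 * inner ℝ v x) • v := by
  simp [axisScale, LinearMap.transvection]

theorem inner_axisScale {v : 𝔼} (hv : v ≠ 0) (σ : ℝ) (x : 𝔼) :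
    inner ℝ v (axisScale v σ x) = σ * inner ℝ v x := by
  have : ‖v‖ ≠ 0 := norm_ne_zero_iff.2 hv
  rw [axisScale_apply, inner_add_right, inner_smul_right, real_inner_self_eq_norm_sq]
  field_simp
  ring

theorem det_axisScale {v : 𝔼} (hv : v ≠ 0) (σ : ℝ) : (axisScale v σ).det = σ := by
  have : ‖v‖ ≠ 0 := norm_ne_zero_iff.2 hv
  rw [axisScale, LinearMap.transvection.det]
  simp only [LinearMap.smul_apply, innerₗ_apply_apply, real_inner_self_eq_norm_sq, smul_eq_mul]
  field_simp
  ring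

theorem axisScale_zero_axisScale {v : 𝔼} (hv : v ≠ 0) (σ : ℝ) (x : 𝔼) :
    axisScale v 0 (axisScale v σ x) = axisScale v 0 x := by
  rw [axisScale_apply v 0, inner_axisScale hv, axisScale_apply v 0 x, axisScale_apply v σ x,
    add_assoc, ← add_smul]
  congr 2
  ring

theorem axisScale_eq_zero_add (v : 𝔼) (σ : ℝ) (x : 𝔼) :
    axisScale v σ x = axisScale v 0 x + (σ * (inner ℝ v x / ‖v‖ ^ 2)) • v := by
  rw [axisScale_apply, axisScale_apply, add_assoc, ← add_smul]
  congr 2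
  ring

theorem axisScale_one (v x : 𝔼) : axisScale v 1 x = x := by simp [axisScale_apply]

theorem axisScale_zero_of_inner_eq_zero {v x : 𝔼} (hx : inner ℝ v x = 0) :
    axisScale v 0 x = x := by
  simp [axisScale_apply, hx]

theorem axisScale_zero_self {v : 𝔼} (hv : v ≠ 0) : axisScale v 0 v = 0 := by
  have : ‖v‖ ≠ 0 := norm_ne_zero_iff.2 hv
  rw [axisScale_apply, real_inner_self_eq_norm_sq]
  field_simp
  simp

theorem continuous_axisScale (v : 𝔼) (σ : ℝ) : Continuous (axisScale v σ) :=
  (axisScale v σ).continuous_of_finiteDimensional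

theorem integral_comp_axisScale {v : 𝔼} (hv : v ≠ 0) {σ : ℝ} (hσ : 0 < σ) {f : 𝔼 → ℝ}
    (hf : Measurable f) : ∫ x, f (axisScale v σ x) = σ⁻¹ * ∫ x, f x := by
  have hdet : (axisScale v σ).det ≠ 0 := by rw [det_axisScale hv]; exact hσ.ne'
  rw [← integral_map (continuous_axisScale v σ).measurable.aemeasurable
    hf.stronglyMeasurable.aestronglyMeasurable,
    Measure.map_linearMap_addHaar_eq_smul_addHaar volume hdet, integral_smul_measure,
    det_axisScale hv, abs_of_pos (inv_pos.2 hσ), ENNReal.toReal_ofReal (inv_pos.2 hσ).le,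
    smul_eq_mul]

/-! ### The half-infinite prism over a facet -/

/-- The half-infinite prism, in the direction `-v`, over the section of `W` by the hyperplane
orthogonal to `v`. -/
def halfPrism {n : ℕ} (v : EuclideanSpace ℝ (Fin n)) (W : Set (EuclideanSpace ℝ (Fin n))) :
    Set (EuclideanSpace ℝ (Fin n)) :=
  {x | inner ℝ v x ≤ 0 ∧ axisScale v 0 x ∈ W}

theorem continuous_inner_left (v : 𝔼) : Continuous fun x : 𝔼 => inner ℝ v x := by fun_prop

theorem isClosed_halfPrism (v : 𝔼) {W : Set 𝔼} (hW : IsClosed W) : IsClosed (halfPrism v W) := by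
  have e : halfPrism v W = {x | inner ℝ v x ≤ 0} ∩ axisScale v 0 ⁻¹' W := Set.ext fun _ => Iff.rfl
  rw [e]
  exact (isClosed_le (continuous_inner_left v) continuous_const).inter
    (hW.preimage (continuous_axisScale v 0))

theorem axisScale_mem_halfPrism {v : 𝔼} (hv : v ≠ 0) {W : Set 𝔼} {σ : ℝ} (hσ : 0 < σ) (x : 𝔼) :
    axisScale v σ x ∈ halfPrism v W ↔ x ∈ halfPrism v W := by
  simp only [halfPrism, Set.mem_ofPred_eq, inner_axisScale hv, axisScale_zero_axisScale hv]
  rw [mul_nonpos_iff_pos_imp_nonpos]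
  constructor
  · exact fun h => ⟨h.1.1 hσ, h.2⟩
  · exact fun h => ⟨⟨fun _ => h.1, fun _ => hσ.le⟩, h.2⟩

theorem integrableOn_halfPrism {v : 𝔼} (hv : v ≠ 0) {W : Set 𝔼} (hW : IsClosed W)
    (hb : Bornology.IsBounded W) :
    IntegrableOn (fun x => Real.exp (inner ℝ v x)) (halfPrism v W) := by
  obtain ⟨R, hR0, hR⟩ := hb.exists_pos_norm_le
  have hvn : 0 < ‖v‖ := norm_pos_iff.2 hv
  set D : ℝ := 1 + R + 1 / ‖v‖ with hD
  have hint : Integrable fun x : 𝔼 =>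
      (D ^ (n + 1) * ((n + 1).factorial * Real.exp 1)) * (1 + ‖x‖) ^ (-((n : ℝ) + 1)) :=
    (integrable_one_add_norm (by simp)).const_mul _
  refine Integrable.mono' hint.integrableOn
    (by fun_prop : Continuous fun x : 𝔼 => Real.exp (inner ℝ v x)).aestronglyMeasurable ?_
  refine (ae_restrict_iff' (isClosed_halfPrism v hW).measurableSet).2 (ae_of_all _ ?_)
  rintro x ⟨hx0, hxW⟩
  rw [Real.norm_eq_abs, Real.abs_exp]
  set u : ℝ := -inner ℝ v x with hu
  have hu0 : 0 ≤ u := by linarith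
  have hnorm : 1 + ‖x‖ ≤ D * (1 + u) := by
    have e : x = axisScale v 0 x + (1 * (inner ℝ v x / ‖v‖ ^ 2)) • v := by
      rw [← axisScale_eq_zero_add, axisScale_one]
    have h1 : ‖x‖ ≤ R + u / ‖v‖ := by
      calc ‖x‖ = ‖axisScale v 0 x + (1 * (inner ℝ v x / ‖v‖ ^ 2)) • v‖ := by rw [← e]
        _ ≤ ‖axisScale v 0 x‖ + ‖(1 * (inner ℝ v x / ‖v‖ ^ 2)) • v‖ := norm_add_le _ _
        _ ≤ R + u / ‖v‖ := by
          refine add_le_add (hR _ hxW) (le_of_eq ?_)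
          rw [norm_smul, one_mul, Real.norm_eq_abs, abs_div, abs_of_nonpos hx0,
            abs_of_nonneg (by positivity), hu]
          field_simp
    have h2 : D * (1 + u) = 1 + R + u / ‖v‖ + (1 / ‖v‖ + u + R * u) := by
      rw [hD]; field_simp; ring
    have : 0 ≤ 1 / ‖v‖ + u + R * u := by positivity
    linarith
  have hpow : (1 + ‖x‖) ^ (n + 1) ≤
      D ^ (n + 1) * ((n + 1).factorial * Real.exp 1) * Real.exp u := by
    have h3 := Real.pow_div_factorial_le_exp (1 + u) (by linarith) (n + 1)
    rw [div_le_iff₀ (by positivity), Real.exp_add] at h3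
    calc (1 + ‖x‖) ^ (n + 1) ≤ (D * (1 + u)) ^ (n + 1) := by gcongr
      _ = D ^ (n + 1) * (1 + u) ^ (n + 1) := mul_pow _ _ _
      _ ≤ D ^ (n + 1) * (Real.exp 1 * Real.exp u * (n + 1).factorial) := by gcongr
      _ = _ := by ring
  have hx1 : (0 : ℝ) < 1 + ‖x‖ := by positivity
  have e2 : (1 + ‖x‖) ^ (-((n : ℝ) + 1)) = ((1 + ‖x‖) ^ (n + 1))⁻¹ := by
    rw [Real.rpow_neg hx1.le]
    congr 1
    exact_mod_cast Real.rpow_natCast (1 + ‖x‖) (n + 1)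
  have e3 : Real.exp (inner ℝ v x) = (Real.exp u)⁻¹ := by rw [← Real.exp_neg, hu, neg_neg]
  rw [e2, e3, ← div_eq_mul_inv, inv_eq_one_div, div_le_div_iff₀ (Real.exp_pos u) (by positivity)]
  linarith

/-- The integral of `exp ⟪v, ·⟫` over the half-infinite prism: up to a constant, the area of the
section of `W` by the hyperplane orthogonal to `v`. -/
noncomputable def prismMass {n : ℕ} (v : EuclideanSpace ℝ (Fin n))
    (W : Set (EuclideanSpace ℝ (Fin n))) : ℝ :=
  ∫ x in halfPrism v W, Real.exp (inner ℝ v x)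

theorem setIntegral_halfPrism {v : 𝔼} (hv : v ≠ 0) {W : Set 𝔼} (hW : IsClosed W) {t : ℝ}
    (ht : 0 < t) :
    t * ∫ x in halfPrism v W, Real.exp (t * inner ℝ v x) = prismMass v W := by
  have hm := (isClosed_halfPrism v hW).measurableSet
  have hf : Measurable ((halfPrism v W).indicator fun x => Real.exp (t * inner ℝ v x)) :=
    Measurable.indicator (by fun_prop) hm
  have := integral_comp_axisScale hv (inv_pos.2 ht) hf
  rw [inv_inv, integral_indicator hm] at this
  rw [← this, prismMass, ← integral_indicator hm]
  congr 1
  ext x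
  by_cases hx : x ∈ halfPrism v W
  · rw [Set.indicator_of_mem ((axisScale_mem_halfPrism hv (inv_pos.2 ht) x).2 hx),
      Set.indicator_of_mem hx, inner_axisScale hv, mul_inv_cancel_left₀ ht.ne']
  · rw [Set.indicator_of_notMem (mt (axisScale_mem_halfPrism hv (inv_pos.2 ht) x).1 hx),
      Set.indicator_of_notMem hx]

/-! ### Bodies with a facet and its opposite translate -/

/-- A convex body `W` in the half-space `⟪v, ·⟫ ≤ 0` that meets the boundary hyperplane in a facet
with `0` in its relative interior, and that also contains the translate of this facet by `-v`. -/
structure IsFacetBody {n : ℕ} (v : EuclideanSpace ℝ (Fin n))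
    (W : Set (EuclideanSpace ℝ (Fin n))) : Prop where
  ne_zero : v ≠ 0
  isClosed : IsClosed W
  isBounded : Bornology.IsBounded W
  convex : Convex ℝ W
  inner_nonpos : ∀ x ∈ W, inner ℝ v x ≤ 0
  facet : ∃ ε > 0, ∀ x, inner ℝ v x = 0 → ‖x‖ < ε → x ∈ W
  sub_mem : ∀ x ∈ W, inner ℝ v x = 0 → x - v ∈ W

namespace IsFacetBody

variable {v : EuclideanSpace ℝ (Fin n)} {W : Set (EuclideanSpace ℝ (Fin n))}

theorem sub_smul_mem (H : IsFacetBody v W) {x : 𝔼} (hx : x ∈ W) (h0 : inner ℝ v x = 0) {r : ℝ}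
    (hr0 : 0 ≤ r) (hr1 : r ≤ 1) : x - r • v ∈ W := by
  have := H.convex hx (H.sub_mem x hx h0) (sub_nonneg.2 hr1) hr0 (by ring)
  convert this using 1
  module

/-- The part of the half-infinite prism of depth at most one lies in the body. -/
theorem axisScale_mem_of_halfPrism (H : IsFacetBody v W) {x : 𝔼} (hx : x ∈ halfPrism v W) {σ : ℝ}
    (hσ : 0 ≤ σ) (h : -‖v‖ ^ 2 ≤ σ * inner ℝ v x) : axisScale v σ x ∈ W := by
  have hvn : 0 < ‖v‖ ^ 2 := by have := norm_pos_iff.2 H.ne_zero; positivity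
  have h0 : inner ℝ v (axisScale v 0 x) = 0 := by rw [inner_axisScale H.ne_zero, zero_mul]
  have := H.sub_smul_mem hx.2 h0 (r := -(σ * (inner ℝ v x / ‖v‖ ^ 2)))
    (neg_nonneg.2 (mul_nonpos_of_nonneg_of_nonpos hσ (div_nonpos_of_nonpos_of_nonneg hx.1 hvn.le)))
    (by rw [← mul_div_assoc, ← neg_div, div_le_one hvn]; linarith)
  rwa [neg_smul, sub_neg_eq_add, ← axisScale_eq_zero_add] at this

theorem interior_nonempty (H : IsFacetBody v W) : (interior W).Nonempty := by
  obtain ⟨ε, hε, hf⟩ := H.facet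
  have hv := H.ne_zero
  have hvn : 0 < ‖v‖ ^ 2 := by have := norm_pos_iff.2 H.ne_zero; positivity
  let U : Set 𝔼 := {x | -‖v‖ ^ 2 < inner ℝ v x} ∩
    ({x | inner ℝ v x < 0} ∩ {x | ‖axisScale v 0 x‖ < ε})
  have hU : IsOpen U :=
    (isOpen_lt continuous_const (continuous_inner_left v)).inter
      ((isOpen_lt (continuous_inner_left v) continuous_const).inter
        (isOpen_lt (continuous_axisScale v 0).norm continuous_const))
  refine ⟨-(2⁻¹ : ℝ) • v, interior_maximal (s := W) (t := U) ?_ hU ?_⟩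
  · rintro x ⟨h1, h2, h3⟩
    rw [Set.mem_ofPred_eq] at h1 h2 h3
    have := H.axisScale_mem_of_halfPrism (x := x) (σ := 1)
      ⟨h2.le, hf _ (by rw [inner_axisScale hv, zero_mul]) h3⟩ zero_le_one (by linarith)
    rwa [axisScale_one] at this
  · refine ⟨?_, ?_, ?_⟩
    · rw [Set.mem_ofPred_eq, inner_smul_right, real_inner_self_eq_norm_sq]; linarith
    · rw [Set.mem_ofPred_eq, inner_smul_right, real_inner_self_eq_norm_sq]; linarith
    · rw [Set.mem_ofPred_eq, map_smul, axisScale_zero_self hv]; simpa using hε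

theorem prismMass_pos (H : IsFacetBody v W) : 0 < prismMass v W := by
  have hv := H.ne_zero
  obtain ⟨ε, hε, hf⟩ := H.facet
  have hvn : 0 < ‖v‖ ^ 2 := by have := norm_pos_iff.2 H.ne_zero; positivity
  let U : Set 𝔼 := {x | inner ℝ v x < 0} ∩ {x | ‖axisScale v 0 x‖ < ε}
  have hU : IsOpen U := (isOpen_lt (continuous_inner_left v) continuous_const).inter
      (isOpen_lt (continuous_axisScale v 0).norm continuous_const)
  have hne : U.Nonempty := ⟨-v,
    by rw [Set.mem_ofPred_eq, inner_neg_right, real_inner_self_eq_norm_sq]; linarith,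
    by rw [Set.mem_ofPred_eq, map_neg, axisScale_zero_self hv]; simpa using hε⟩
  have hsub : U ⊆ halfPrism v W := fun x hx =>
    ⟨hx.1.le, hf _ (by rw [inner_axisScale hv, zero_mul]) hx.2⟩
  rw [prismMass, setIntegral_pos_iff_support_of_nonneg_ae (ae_of_all _ fun x => (Real.exp_pos _).le)
    (integrableOn_halfPrism hv H.isClosed H.isBounded)]
  have hs : (Function.support fun x : 𝔼 => Real.exp (inner ℝ v x)) = Set.univ :=
    Set.eq_univ_of_forall fun x => (Real.exp_pos _).ne'
  rw [hs, Set.univ_inter]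
  exact (hU.measure_pos volume hne).trans_le (measure_mono hsub)

/-- The exponential moments of the body in the direction `v` are asymptotic to those of the
half-infinite prism over its facet. -/
theorem tendsto_mul_setIntegral (H : IsFacetBody v W) :
    Tendsto (fun t : ℝ => t * ∫ x in W, Real.exp (t * inner ℝ v x)) atTop
      (𝓝 (prismMass v W)) := by
  have hv := H.ne_zero
  have hWm := H.isClosed.measurableSet
  have hvn : 0 < ‖v‖ ^ 2 := by have := norm_pos_iff.2 H.ne_zero; positivity
  let K : Set 𝔼 := axisScale v 0 '' W
  have hKc : IsCompact K :=
    (Metric.isCompact_of_isClosed_isBounded H.isClosed H.isBounded).image (continuous_axisScale v 0)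
  have hKm := (isClosed_halfPrism v hKc.isClosed).measurableSet
  -- Stretching by the factor `t` along `v` turns the moment into an integral of a fixed weight.
  have key : ∀ t : ℝ, 0 < t → t * ∫ x in W, Real.exp (t * inner ℝ v x) =
      ∫ x, (axisScale v t⁻¹ ⁻¹' W).indicator (fun x => Real.exp (inner ℝ v x)) x := by
    intro t ht
    have hf : Measurable (W.indicator fun x => Real.exp (t * inner ℝ v x)) :=
      Measurable.indicator (by fun_prop) hWm
    have := integral_comp_axisScale hv (inv_pos.2 ht) hf
    rw [inv_inv, integral_indicator hWm] at this
    rw [← this]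
    congr 1
    ext x
    by_cases hx : axisScale v t⁻¹ x ∈ W
    · rw [Set.indicator_of_mem hx, Set.indicator_of_mem (by exact hx), inner_axisScale hv,
        mul_inv_cancel_left₀ ht.ne']
    · rw [Set.indicator_of_notMem hx, Set.indicator_of_notMem (by exact hx)]
  rw [prismMass, ← integral_indicator (isClosed_halfPrism v H.isClosed).measurableSet]
  refine Tendsto.congr' ((eventually_gt_atTop 0).mono fun t ht => (key t ht).symm) ?_
  refine tendsto_integral_filter_of_dominated_convergence
    ((halfPrism v K).indicator fun x => Real.exp (inner ℝ v x)) ?_ ?_ ?_ ?_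
  · refine Eventually.of_forall fun t => Measurable.aestronglyMeasurable ?_
    exact Measurable.indicator (by fun_prop) ((continuous_axisScale v _).measurable hWm)
  · filter_upwards [eventually_gt_atTop 0] with t ht
    refine ae_of_all _ fun x => ?_
    rw [Real.norm_eq_abs, abs_of_nonneg (Set.indicator_nonneg (fun _ _ => (Real.exp_pos _).le) x)]
    refine Set.indicator_le_indicator_of_subset ?_ (fun _ => (Real.exp_pos _).le) x
    intro y hy
    refine ⟨?_, axisScale v t⁻¹ y, hy, axisScale_zero_axisScale hv _ _⟩
    have := H.inner_nonpos _ hy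
    rw [inner_axisScale hv] at this
    by_contra hcon
    push Not at hcon
    have : 0 < t⁻¹ * inner ℝ v y := mul_pos (inv_pos.2 ht) hcon
    linarith
  · rw [integrable_indicator_iff hKm]
    exact integrableOn_halfPrism hv hKc.isClosed hKc.isBounded
  · refine ae_of_all _ fun x => ?_
    refine tendsto_const_nhds.congr' ?_
    by_cases hx : x ∈ halfPrism v W
    · have hlim : Tendsto (fun t : ℝ => t⁻¹ * inner ℝ v x) atTop (𝓝 0) := by
        simpa using tendsto_inv_atTop_zero.mul_const (inner ℝ v x)
      filter_upwards [hlim.eventually_const_le (neg_lt_zero.2 hvn), eventually_gt_atTop 0]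
        with t ht ht0
      rw [Set.indicator_of_mem hx, Set.indicator_of_mem]
      exact H.axisScale_mem_of_halfPrism hx (inv_pos.2 ht0).le ht
    · suffices h : ∀ᶠ t in atTop, axisScale v t⁻¹ x ∉ W by
        filter_upwards [h] with t ht
        rw [Set.indicator_of_notMem hx, Set.indicator_of_notMem (by exact ht)]
      by_cases h0 : inner ℝ v x ≤ 0
      · have hx' : axisScale v 0 x ∉ W := fun h => hx ⟨h0, h⟩
        have hlim : Tendsto (fun t : ℝ => axisScale v t⁻¹ x) atTop (𝓝 (axisScale v 0 x)) := by
          have h1 : Continuous fun σ : ℝ => axisScale v σ x := by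
            simp only [axisScale_apply]; fun_prop
          exact (h1.tendsto 0).comp tendsto_inv_atTop_zero
        exact hlim.eventually (H.isClosed.isOpen_compl.mem_nhds hx')
      · filter_upwards [eventually_gt_atTop 0] with t ht hmem
        have := H.inner_nonpos _ hmem
        rw [inner_axisScale hv] at this
        have : 0 < t⁻¹ * inner ℝ v x := mul_pos (inv_pos.2 ht) (not_le.1 h0)
        linarith

/-! ### Bodies that are not prisms over a facet -/

/-- A body with a point `q` outside the prism over its facet contains a full-dimensional piece whose
homothetic images towards a point `f` of the facet avoid the prism: `f` maximizes, over the facet, a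
linear functional that separates the projection of `q` from the facet. -/
theorem exists_open_homothety_disjoint (H : IsFacetBody v W) {q : 𝔼} (hq : q ∈ W)
    (hq' : axisScale v 0 q ∉ W) :
    ∃ f ∈ W, inner ℝ v f = 0 ∧ ∃ U : Set 𝔼, IsOpen U ∧ U.Nonempty ∧ U ⊆ W ∧
      ∀ r : ℝ, 0 < r → ∀ x ∈ U, AffineMap.homothety f r x ∉ halfPrism v W := by
  have hv := H.ne_zero
  let F : Set 𝔼 := W ∩ {x | inner ℝ v x = 0}
  have hWc : IsCompact W := Metric.isCompact_of_isClosed_isBounded H.isClosed H.isBounded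
  have hFc : IsCompact F := hWc.inter_right
    (isClosed_eq (continuous_inner_left v) continuous_const)
  have hFconv : Convex ℝ F := H.convex.inter <| by
    intro x hx y hy a b _ _ _
    rw [Set.mem_ofPred_eq] at hx hy ⊢
    simp [inner_add_right, inner_smul_right, hx, hy]
  have hFne : F.Nonempty := by
    obtain ⟨ε, hε, hf⟩ := H.facet
    exact ⟨0, hf 0 (by simp) (by simpa using hε), by rw [Set.mem_ofPred_eq]; simp⟩
  obtain ⟨g, u, hgF, hgq⟩ := geometric_hahn_banach_closed_point hFconv hFc.isClosed
    (fun h : axisScale v 0 q ∈ F => hq' h.1)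
  obtain ⟨f, hfF, hfmax⟩ := hFc.exists_isMaxOn hFne g.continuous.continuousOn
  have hf0 : inner ℝ v f = 0 := hfF.2
  have hgc : Continuous fun x => g (axisScale v 0 x) := g.continuous.comp (continuous_axisScale v 0)
  let O : Set 𝔼 := {x | g f < g (axisScale v 0 x)}
  have hO : IsOpen O := isOpen_lt continuous_const hgc
  have hqO : q ∈ O := (hgF f hfF).trans hgq
  refine ⟨f, hfF.1, hf0, interior W ∩ O, isOpen_interior.inter hO, ?_,
    Set.inter_subset_left.trans interior_subset, ?_⟩
  · have hqcl : q ∈ closure (interior W) := by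
      rw [H.convex.closure_interior_eq_closure_of_nonempty_interior H.interior_nonempty]
      exact subset_closure hq
    obtain ⟨z, hzO, hzi⟩ := mem_closure_iff.1 hqcl O hO hqO
    exact ⟨z, hzi, hzO⟩
  · rintro r hr x ⟨-, hxO⟩ hmem
    have hxO' : g f < g (axisScale v 0 x) := hxO
    have h1 : g (axisScale v 0 (AffineMap.homothety f r x)) ≤ g f :=
      hfmax ⟨hmem.2, by rw [Set.mem_ofPred_eq, inner_axisScale hv, zero_mul]⟩
    rw [AffineMap.homothety_apply, vsub_eq_sub, vadd_eq_add, map_add, map_smul, map_sub,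
      axisScale_zero_of_inner_eq_zero hf0, map_add, map_smul, map_sub, smul_eq_mul] at h1
    have := mul_pos hr (sub_pos.2 hxO')
    linarith

/-- If the body is not contained in the prism over its facet, then its exponential moments exceed
those of the prism by an amount that decays only polynomially. -/
theorem exists_lower_bound (H : IsFacetBody v W) {q : 𝔼} (hq : q ∈ W)
    (hq' : axisScale v 0 q ∉ W) :
    ∃ c > 0, ∀ t : ℝ, 1 ≤ t →
      prismMass v W - t * Real.exp (-(t - 1) * ‖v‖ ^ 2) * prismMass v W + c * t / t ^ n ≤
        t * ∫ x in W, Real.exp (t * inner ℝ v x) := by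
  have hv := H.ne_zero
  obtain ⟨f, hfW, hf0, U, hUo, hUne, hUW, hUd⟩ := H.exists_open_homothety_disjoint hq hq'
  obtain ⟨R, hR0, hR⟩ := H.isBounded.exists_pos_norm_le
  have hUpos : 0 < volume.real U :=
    ENNReal.toReal_pos (hUo.measure_pos volume hUne).ne'
      ((H.isBounded.subset hUW).measure_lt_top).ne
  refine ⟨Real.exp (-(‖v‖ * R)) * volume.real U, by positivity, fun t ht => ?_⟩
  have ht0 : 0 < t := by linarith
  have hcont : Continuous fun x : 𝔼 => Real.exp (t * inner ℝ v x) := by fun_prop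
  have hWint : IntegrableOn (fun x => Real.exp (t * inner ℝ v x)) W := by
    have := integrableOn_exp_inner H.isBounded (t • v)
    simpa only [inner_smul_left, conj_trivial] using this
  set Q := halfPrism v W with hQ
  have hQm : MeasurableSet Q := (isClosed_halfPrism v H.isClosed).measurableSet
  have hQint1 : IntegrableOn (fun x => Real.exp (inner ℝ v x)) Q :=
    integrableOn_halfPrism hv H.isClosed H.isBounded
  have hQint : IntegrableOn (fun x => Real.exp (t * inner ℝ v x)) Q := by
    refine Integrable.mono' hQint1 hcont.aestronglyMeasurable ?_
    refine (ae_restrict_iff' hQm).2 (ae_of_all _ fun x hx => ?_)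
    rw [Real.norm_eq_abs, Real.abs_exp, Real.exp_le_exp]
    exact mul_le_of_one_le_left hx.1 ht
  let T : Set 𝔼 := {x | -‖v‖ ^ 2 ≤ inner ℝ v x}
  have hTm : MeasurableSet T :=
    (isClosed_le continuous_const (continuous_inner_left v)).measurableSet
  -- The homothetic image of ratio `1 / t` has depth of order `1 / t`.
  set B : Set 𝔼 := AffineMap.homothety f t⁻¹ '' U with hB
  have hBo : IsOpen B := AffineMap.homothety_isOpenMap f _ (inv_ne_zero ht0.ne') _ hUo
  have hBW : B ⊆ W := by
    rintro _ ⟨x, hx, rfl⟩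
    have := H.convex hfW (hUW hx) (a := 1 - t⁻¹) (b := t⁻¹)
      (sub_nonneg.2 (inv_le_one_of_one_le₀ ht)) (by positivity) (by ring)
    convert this using 1
    rw [AffineMap.homothety_apply, vsub_eq_sub, vadd_eq_add]
    module
  have hPW : Q ∩ T ⊆ W := by
    rintro x ⟨hx, hxT⟩
    have := H.axisScale_mem_of_halfPrism hx zero_le_one (by rw [one_mul]; exact hxT)
    rwa [axisScale_one] at this
  have hdisj : Disjoint (Q ∩ T) B := by
    rw [Set.disjoint_left]
    rintro _ ⟨hx, -⟩ ⟨y, hy, rfl⟩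
    exact hUd t⁻¹ (by positivity) y hy hx
  have h1 : (∫ x in Q ∩ T, Real.exp (t * inner ℝ v x)) + ∫ x in B, Real.exp (t * inner ℝ v x) ≤
      ∫ x in W, Real.exp (t * inner ℝ v x) := by
    rw [← setIntegral_union hdisj hBo.measurableSet (hWint.mono_set hPW) (hWint.mono_set hBW)]
    exact setIntegral_mono_set hWint (ae_of_all _ fun x => (Real.exp_pos _).le)
      (Set.union_subset hPW hBW).eventuallyLE
  have h2 : Real.exp (-(‖v‖ * R)) * volume.real U / t ^ n ≤
      ∫ x in B, Real.exp (t * inner ℝ v x) := by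
    have hvol : volume.real B = volume.real U / t ^ n := by
      rw [hB, Measure.real, Measure.addHaar_image_homothety, ENNReal.toReal_mul,
        ENNReal.toReal_ofReal (abs_nonneg _), abs_of_nonneg (by positivity), Measure.real]
      rw [finrank_euclideanSpace_fin, inv_pow, inv_mul_eq_div]
    have := setIntegral_mono_on (μ := volume) (s := B) (f := fun _ => Real.exp (-(‖v‖ * R)))
      (g := fun x => Real.exp (t * inner ℝ v x))
      (integrableOn_const ((H.isBounded.subset hBW).measure_lt_top).ne) (hWint.mono_set hBW)
      hBo.measurableSet ?_
    · rw [setIntegral_const, hvol, smul_eq_mul] at this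
      refine le_trans (le_of_eq ?_) this
      ring
    · rintro _ ⟨x, hx, rfl⟩
      rw [Real.exp_le_exp, AffineMap.homothety_apply, vsub_eq_sub, vadd_eq_add, inner_add_right,
        hf0, inner_smul_right, inner_sub_right, hf0, add_zero, sub_zero,
        mul_inv_cancel_left₀ ht0.ne']
      have h3 := (abs_le.1 (abs_real_inner_le_norm v x)).1
      have h4 : ‖v‖ * ‖x‖ ≤ ‖v‖ * R := by gcongr; exact hR x (hUW hx)
      linarith
  have h3 : (∫ x in Q, Real.exp (t * inner ℝ v x)) ≤
      (∫ x in Q ∩ T, Real.exp (t * inner ℝ v x)) +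
        Real.exp (-(t - 1) * ‖v‖ ^ 2) * prismMass v W := by
    rw [← integral_inter_add_sdiff hTm hQint]
    gcongr
    have h4 : ∫ x in Q \ T, Real.exp (t * inner ℝ v x) ≤
        ∫ x in Q \ T, Real.exp (-(t - 1) * ‖v‖ ^ 2) * Real.exp (inner ℝ v x) := by
      refine setIntegral_mono_on (hQint.mono_set Set.sdiff_subset)
        ((hQint1.mono_set Set.sdiff_subset).const_mul _) (hQm.diff hTm) ?_
      rintro x ⟨-, hxT⟩
      have hxT' : inner ℝ v x < -‖v‖ ^ 2 := not_le.1 hxT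
      rw [← Real.exp_add, Real.exp_le_exp]
      nlinarith
    refine h4.trans ?_
    rw [integral_const_mul]
    gcongr
    exact setIntegral_mono_set hQint1 (ae_of_all _ fun x => (Real.exp_pos _).le)
      Set.sdiff_subset.eventuallyLE
  have h5 := setIntegral_halfPrism hv H.isClosed ht0
  have h6 := mul_le_mul_of_nonneg_left h1 ht0.le
  have h7 := mul_le_mul_of_nonneg_left h2 ht0.le
  have h8 := mul_le_mul_of_nonneg_left h3 ht0.le
  rw [h5] at h8
  have e : Real.exp (-(‖v‖ * R)) * volume.real U * t / t ^ n =
      t * (Real.exp (-(‖v‖ * R)) * volume.real U / t ^ n) := by ring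
  rw [e]
  linarith

/-- The exponential moments of a body that is not contained in the prism over its facet satisfy no
two-scale relation with an exponential sum as a multiplier. -/
theorem not_expSum_relation (H : IsFacetBody v W) {q : 𝔼} (hq : q ∈ W)
    (hq' : axisScale v 0 q ∉ W) {h : ℝ} (h0 : 0 < h) (h1 : h < 1) {M : ℝ → ℝ} (hM : M ∈ expSums)
    (m : ℕ) (hrel : ∀ t : ℝ, (∫ x in W, Real.exp (t * inner ℝ v x)) ^ (m + 1) =
      M t * (∫ x in W, Real.exp (h * t * inner ℝ v x)) ^ (m + 1)) : False := by
  have hvn : 0 < ‖v‖ ^ 2 := by have := norm_pos_iff.2 H.ne_zero; positivity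
  set a := prismMass v W
  obtain ⟨D, hD⟩ := le_limit_add_of_expSum_relation (k := n + 1) h0 h1 H.prismMass_pos
    H.tendsto_mul_setIntegral (expSums.smul_mem ((h ^ (m + 1))⁻¹) hM) m
    (fun t _ => by
      rw [mul_pow, hrel t, Pi.smul_apply, smul_eq_mul, mul_pow, mul_pow]
      field_simp) n.succ_ne_zero
  obtain ⟨c, hc, hlow⟩ := H.exists_lower_bound hq hq'
  have hlim : Tendsto (fun t : ℝ => a * Real.exp (‖v‖ ^ 2) * (t ^ (n + 2) *
      Real.exp (-‖v‖ ^ 2 * t))) atTop (𝓝 0) := by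
    have := (Real.tendsto_pow_mul_exp_neg_atTop_nhds_zero (n + 2)).comp
      ((tendsto_const_mul_atTop_of_pos hvn).2 tendsto_id)
    have := this.const_mul (a * Real.exp (‖v‖ ^ 2) / (‖v‖ ^ 2) ^ (n + 2))
    rw [mul_zero] at this
    refine this.congr fun t => ?_
    simp only [Function.comp_apply, id, mul_pow, neg_mul]
    field_simp
  have hbig : Tendsto (fun t : ℝ => c * t ^ 2) atTop atTop :=
    (tendsto_pow_atTop two_ne_zero).const_mul_atTop hc
  obtain ⟨t, hu, hsmall, hlarge, ht⟩ := (hD.and ((hlim.eventually_le_const one_pos).and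
    ((hbig.eventually_gt_atTop (D + 1)).and (eventually_ge_atTop 1)))).exists
  have ht0 : 0 < t := by linarith
  have := (hlow t ht).trans hu
  have e1 : c * t / t ^ n = c * t ^ 2 / t ^ (n + 1) := by field_simp; ring
  have e2 : t * Real.exp (-(t - 1) * ‖v‖ ^ 2) * a = (a * Real.exp (‖v‖ ^ 2) * (t ^ (n + 2) *
      Real.exp (-‖v‖ ^ 2 * t))) / t ^ (n + 1) := by
    have : Real.exp (-(t - 1) * ‖v‖ ^ 2) = Real.exp (‖v‖ ^ 2) * Real.exp (-‖v‖ ^ 2 * t) := by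
      rw [← Real.exp_add]; ring_nf
    rw [this]
    field_simp
    ring
  have e3 : (a * Real.exp (‖v‖ ^ 2) * (t ^ (n + 2) * Real.exp (-‖v‖ ^ 2 * t))) / t ^ (n + 1) ≤
      1 / t ^ (n + 1) := by gcongr
  have e4 : (D + 1) / t ^ (n + 1) < c * t ^ 2 / t ^ (n + 1) := by gcongr
  rw [add_div] at e4
  rw [e1, e2] at this
  linarith

end IsFacetBody

/-! ### Voronoi cells -/

theorem mem_voronoiCell_iff {Λ : Submodule ℤ 𝔼} {x : 𝔼} :
    x ∈ voronoiCell Λ ↔ ∀ z ∈ Λ, 2 * inner ℝ x z ≤ ‖z‖ ^ 2 := by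
  refine forall₂_congr fun z _ => ?_
  rw [dist_zero_right, dist_eq_norm, ← sq_le_sq₀ (norm_nonneg _) (norm_nonneg _),
    norm_sub_sq_real]
  constructor <;> intro h <;> linarith

theorem isClosed_voronoiCell (Λ : Submodule ℤ 𝔼) : IsClosed (voronoiCell Λ) := by
  have e : voronoiCell Λ = ⋂ z ∈ Λ, {x | dist x 0 ≤ dist x z} := by
    ext x
    rw [Set.mem_iInter₂]
    rfl
  rw [e]
  exact isClosed_biInter fun z _ => isClosed_le (by fun_prop) (by fun_prop)

theorem convex_voronoiCell (Λ : Submodule ℤ 𝔼) : Convex ℝ (voronoiCell Λ) := by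
  intro x hx y hy a b ha hb hab
  rw [mem_voronoiCell_iff] at hx hy ⊢
  intro z hz
  rw [inner_add_left, inner_smul_left, inner_smul_left]
  simp only [conj_trivial]
  calc 2 * (a * inner ℝ x z + b * inner ℝ y z)
      = a * (2 * inner ℝ x z) + b * (2 * inner ℝ y z) := by ring
    _ ≤ a * ‖z‖ ^ 2 + b * ‖z‖ ^ 2 := by
      gcongr
      · exact hx z hz
      · exact hy z hz
    _ = ‖z‖ ^ 2 := by rw [← add_mul, hab, one_mul]

/-- The linear map to the inner products with the vectors of a basis. -/
noncomputable def innerCoords {n : ℕ} {ι : Type} (b : Module.Basis ι ℝ (EuclideanSpace ℝ (Fin n))) :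
    EuclideanSpace ℝ (Fin n) →ₗ[ℝ] (ι → ℝ) :=
  LinearMap.pi fun i => innerₗ (EuclideanSpace ℝ (Fin n)) (b i)

theorem innerCoords_apply {ι : Type} (b : Module.Basis ι ℝ 𝔼) (x : 𝔼) (i : ι) :
    innerCoords b x i = inner ℝ (b i) x := rfl

theorem innerCoords_injective {ι : Type} (b : Module.Basis ι ℝ 𝔼) :
    Function.Injective (innerCoords b) := by
  rw [injective_iff_map_eq_zero]
  intro x hx
  refine InnerProductSpace.ext_inner_left_basis b fun i => ?_
  rw [← innerCoords_apply, hx, inner_zero_right]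
  rfl

theorem innerCoords_surjective {ι : Type} [Fintype ι] (b : Module.Basis ι ℝ 𝔼) :
    Function.Surjective (innerCoords b) :=
  (LinearMap.injective_iff_surjective_of_finrank_eq_finrank
    (by rw [Module.finrank_eq_card_basis b, Module.finrank_fintype_fun_eq_card])).1
      (innerCoords_injective b)

theorem isBounded_voronoiCell {ι : Type} [Fintype ι] {Λ : Submodule ℤ 𝔼}
    (b : Module.Basis ι ℝ 𝔼) (hb : ∀ i, b i ∈ Λ) : Bornology.IsBounded (voronoiCell Λ) := by
  obtain ⟨K, -, hK⟩ := (innerCoords b).exists_antilipschitzWith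
    (LinearMap.ker_eq_bot.2 (innerCoords_injective b))
  refine (hK.isBounded_preimage (s := Set.Icc (fun i => -(‖b i‖ ^ 2 / 2)) fun i => ‖b i‖ ^ 2 / 2)
    (Metric.isBounded_Icc _ _)).subset fun x hx => ?_
  rw [mem_voronoiCell_iff] at hx
  have h1 : ∀ i, -(‖b i‖ ^ 2 / 2) ≤ inner ℝ (b i) x ∧ inner ℝ (b i) x ≤ ‖b i‖ ^ 2 / 2 := by
    intro i
    have h2 := hx _ (hb i)
    have h3 := hx _ (Λ.neg_mem (hb i))
    rw [inner_neg_right, norm_neg] at h3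
    rw [real_inner_comm]
    constructor <;> linarith
  exact ⟨fun i => (h1 i).1, fun i => (h1 i).2⟩

/-- The Voronoi cell, moved so that the midpoint `v / 2` of a facet lies at the origin, when `v` is
a strictly Voronoi-relevant vector: no other nonzero lattice vector satisfies `⟪v, z⟫ ≥ |z|²`, with
a uniform margin. -/
theorem isFacetBody_preimage {Λ : Submodule ℤ 𝔼} (hb : Bornology.IsBounded (voronoiCell Λ))
    {v : 𝔼} {γ : ℝ} (hv : v ∈ Λ) (hv0 : v ≠ 0) (hγ : 0 < γ)
    (hgap : ∀ z ∈ Λ, z ≠ 0 → z ≠ v → inner ℝ v z + γ ≤ ‖z‖ ^ 2) :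
    IsFacetBody v ((fun x => x + (2⁻¹ : ℝ) • v) ⁻¹' voronoiCell Λ) := by
  have hmem : ∀ x : 𝔼, x ∈ (fun x => x + (2⁻¹ : ℝ) • v) ⁻¹' voronoiCell Λ ↔
      ∀ z ∈ Λ, 2 * inner ℝ x z + inner ℝ v z ≤ ‖z‖ ^ 2 := by
    intro x
    rw [Set.mem_preimage, mem_voronoiCell_iff]
    refine forall₂_congr fun z _ => ?_
    rw [inner_add_left, inner_smul_left]
    simp only [conj_trivial]
    ring_nf
  refine ⟨hv0, (isClosed_voronoiCell Λ).preimage (by fun_prop), ?_, ?_, ?_, ?_, ?_⟩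
  · have : (fun x : 𝔼 => x + (2⁻¹ : ℝ) • v) ⁻¹' voronoiCell Λ =
        (fun x : 𝔼 => x + -((2⁻¹ : ℝ) • v)) '' voronoiCell Λ := by
      rw [Set.image_add_right, neg_neg]
    rw [this]
    obtain ⟨R, hR⟩ := hb.exists_norm_le
    refine isBounded_iff_forall_norm_le.2 ⟨R + ‖-((2⁻¹ : ℝ) • v)‖, ?_⟩
    rintro _ ⟨x, hx, rfl⟩
    exact (norm_add_le _ _).trans (by gcongr; exact hR x hx)
  · exact (convex_voronoiCell Λ).translate_preimage_left _
  · intro x hx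
    have := (hmem x).1 hx v hv
    rw [real_inner_self_eq_norm_sq, real_inner_comm] at this
    linarith
  · refine ⟨min 1 (γ / (2 * (‖v‖ + 2))), by positivity, fun x hx0 hx => (hmem x).2 fun z hz => ?_⟩
    by_cases h0 : z = 0
    · simp [h0]
    by_cases h1 : z = v
    · rw [h1, real_inner_comm, hx0, real_inner_self_eq_norm_sq]; simp
    have hxz : inner ℝ x z ≤ ‖x‖ * ‖z‖ := real_inner_le_norm x z
    -- Long lattice vectors satisfy the inequality by Cauchy–Schwarz, short ones by the margin.
    by_cases hlong : ‖v‖ + 2 ≤ ‖z‖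
    · have h2 : ‖x‖ ≤ 1 := hx.le.trans (min_le_left _ _)
      have h3 : inner ℝ v z ≤ ‖v‖ * ‖z‖ := real_inner_le_norm v z
      have h4 : ‖x‖ * ‖z‖ ≤ 1 * ‖z‖ := by gcongr
      have h5 : (‖v‖ + 2) * ‖z‖ ≤ ‖z‖ * ‖z‖ := by gcongr
      nlinarith
    · have h2 : ‖x‖ ≤ γ / (2 * (‖v‖ + 2)) := hx.le.trans (min_le_right _ _)
      have h3 : ‖x‖ * ‖z‖ ≤ γ / (2 * (‖v‖ + 2)) * (‖v‖ + 2) := by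
        gcongr
        exact (not_le.1 hlong).le
      have h4 : γ / (2 * (‖v‖ + 2)) * (‖v‖ + 2) = γ / 2 := by
        have : ‖v‖ + 2 ≠ 0 := by positivity
        field_simp
      have := hgap z hz h0 h1
      linarith
  · intro x hx hx0
    rw [hmem] at hx ⊢
    intro z hz
    have h1 := hx _ (Λ.add_mem hz hv)
    rw [inner_add_right, inner_add_right, real_inner_comm v x, hx0, real_inner_self_eq_norm_sq,
      norm_add_sq_real, real_inner_comm v z] at h1
    rw [inner_sub_left]
    linarith

/-- If a lattice has a strictly Voronoi-relevant vector `v`, and a further vector `y` with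
`0 < ⟪v, y⟫ < |v|²` whose half lies in the Voronoi cell, then the cell is not a prism over the facet
of `v`, and no shifted family of its splines is refinable. -/
theorem not_isRefinable_of_relevant {ι : Type} [Nonempty ι] {Λ : Submodule ℤ 𝔼}
    (hb : Bornology.IsBounded (voronoiCell Λ)) {v y : 𝔼} {γ : ℝ} (hv : v ∈ Λ) (hy : y ∈ Λ)
    (hγ : 0 < γ) (hgap : ∀ z ∈ Λ, z ≠ 0 → z ≠ v → inner ℝ v z + γ ≤ ‖z‖ ^ 2)
    (hhalf : ∀ z ∈ Λ, inner ℝ y z ≤ ‖z‖ ^ 2) (h0 : 0 < inner ℝ v y) (h1 : inner ℝ v y < ‖v‖ ^ 2)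
    (s : ι → 𝔼) (m : ℕ) : ¬ IsRefinable (splineFamily Λ s m) := by
  intro href
  have hv0 : v ≠ 0 := by rintro rfl; simp at h0
  have hvn : 0 < ‖v‖ ^ 2 := h0.trans h1
  have hm := (isClosed_voronoiCell Λ).measurableSet
  have H := isFacetBody_preimage hb hv hv0 hγ hgap
  set W := (fun x => x + (2⁻¹ : ℝ) • v) ⁻¹' voronoiCell Λ with hW
  have hmoment : ∀ t : ℝ, expMoment (voronoiCell Λ) (t • v) =
      Real.exp (‖v‖ ^ 2 / 2 * t) * ∫ x in W, Real.exp (t * inner ℝ v x) := by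
    intro t
    rw [expMoment, ← integral_add_right_eq_self _ ((2⁻¹ : ℝ) • v),
      ← integral_indicator H.isClosed.measurableSet, ← integral_const_mul]
    congr 1
    ext x
    rw [expWeight_indicator]
    by_cases hx : x ∈ W
    · rw [Set.indicator_of_mem (by exact hx), Set.indicator_of_mem hx, ← Real.exp_add,
        inner_add_right, inner_smul_left, inner_smul_left, inner_smul_right,
        real_inner_self_eq_norm_sq]
      simp only [conj_trivial]
      ring_nf
    · rw [Set.indicator_of_notMem (by exact hx), Set.indicator_of_notMem hx, mul_zero]
  obtain ⟨h, hh0, hh1, M, hM, hrel⟩ := exists_expSum_relation hm hb s m href v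
  have hq : (2⁻¹ : ℝ) • y - (2⁻¹ : ℝ) • v ∈ W := by
    rw [hW, Set.mem_preimage, sub_add_cancel, mem_voronoiCell_iff]
    intro z hz
    rw [inner_smul_left]
    simp only [conj_trivial]
    linarith [hhalf z hz]
  have hq' : axisScale v 0 ((2⁻¹ : ℝ) • y - (2⁻¹ : ℝ) • v) ∉ W := by
    rw [hW, Set.mem_preimage, mem_voronoiCell_iff]
    intro hcon
    have h2 := hcon y hy
    have e : 2 * inner ℝ (axisScale v 0 ((2⁻¹ : ℝ) • y - (2⁻¹ : ℝ) • v) + (2⁻¹ : ℝ) • v) y =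
        ‖y‖ ^ 2 + inner ℝ v y * (1 - inner ℝ v y / ‖v‖ ^ 2) := by
      rw [axisScale_apply]
      simp only [inner_add_left, inner_sub_left, inner_smul_left, inner_sub_right,
        inner_smul_right, conj_trivial, real_inner_self_eq_norm_sq]
      field_simp
      ring
    rw [e] at h2
    have h3 : inner ℝ v y / ‖v‖ ^ 2 < 1 := (div_lt_one hvn).2 h1
    have := mul_pos h0 (sub_pos.2 h3)
    linarith
  refine H.not_expSum_relation hq hq' hh0 hh1
    (exp_mul_mem_expSums hM (-(‖v‖ ^ 2 / 2 * (m + 1) * (1 - h)))) m fun t => ?_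
  have h2 := hrel t
  rw [hmoment, hmoment, mul_pow, mul_pow, ← Real.exp_nat_mul, ← Real.exp_nat_mul] at h2
  refine mul_left_cancel₀ (Real.exp_ne_zero (((m + 1 : ℕ) : ℝ) * (‖v‖ ^ 2 / 2 * t))) (h2.trans ?_)
  rw [mul_assoc (Real.exp (-(‖v‖ ^ 2 / 2 * (m + 1) * (1 - h)) * t)), ← mul_assoc (Real.exp _),
    ← Real.exp_add, mul_left_comm]
  push_cast
  ring_nf

/-! ### Root lattices -/

theorem exists_int_of_mem_span {ι : Type} {b : Module.Basis ι ℝ 𝔼} {G : Matrix ι ι ℤ} {c : ℝ}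
    (hG : ∀ i j, inner ℝ (b i) (b j) = c * (G i j : ℝ)) {x z : 𝔼}
    (hx : x ∈ Submodule.span ℤ (Set.range b)) (hz : z ∈ Submodule.span ℤ (Set.range b)) :
    ∃ k : ℤ, inner ℝ x z = c * k := by
  induction hx, hz using Submodule.span_induction₂ with
  | mem_mem x z hx hz =>
    obtain ⟨i, rfl⟩ := hx
    obtain ⟨j, rfl⟩ := hz
    exact ⟨G i j, hG i j⟩
  | zero_left => exact ⟨0, by simp⟩
  | zero_right => exact ⟨0, by simp⟩
  | add_left x y z _ _ _ hx hy =>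
    obtain ⟨k, hk⟩ := hx
    obtain ⟨l, hl⟩ := hy
    exact ⟨k + l, by rw [inner_add_left, hk, hl]; push_cast; ring⟩
  | add_right x y z _ _ _ hx hy =>
    obtain ⟨k, hk⟩ := hx
    obtain ⟨l, hl⟩ := hy
    exact ⟨k + l, by rw [inner_add_right, hk, hl]; push_cast; ring⟩
  | smul_left r x y _ _ h =>
    obtain ⟨k, hk⟩ := h
    exact ⟨r * k, by rw [← Int.cast_smul_eq_zsmul ℝ, real_inner_smul_left, hk]; push_cast; ring⟩
  | smul_right r x y _ _ h =>
    obtain ⟨k, hk⟩ := h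
    exact ⟨r * k, by rw [← Int.cast_smul_eq_zsmul ℝ, real_inner_smul_right, hk]; push_cast; ring⟩

/-- A lattice whose Gram matrix has all diagonal entries equal to `2` is even. -/
theorem exists_norm_sq_eq_of_mem_span {ι : Type} {b : Module.Basis ι ℝ 𝔼} {G : Matrix ι ι ℤ} {c : ℝ}
    (hG : ∀ i j, inner ℝ (b i) (b j) = c * (G i j : ℝ)) (hdiag : ∀ i, G i i = 2) {x : 𝔼}
    (hx : x ∈ Submodule.span ℤ (Set.range b)) : ∃ k : ℤ, ‖x‖ ^ 2 = 2 * c * k := by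
  induction hx using Submodule.span_induction with
  | mem x hx =>
    obtain ⟨i, rfl⟩ := hx
    exact ⟨1, by rw [← real_inner_self_eq_norm_sq, hG, hdiag]; push_cast; ring⟩
  | zero => exact ⟨0, by simp⟩
  | add x y hx hy ihx ihy =>
    obtain ⟨k, hk⟩ := ihx
    obtain ⟨l, hl⟩ := ihy
    obtain ⟨j, hj⟩ := exists_int_of_mem_span hG hx hy
    exact ⟨k + l + j, by rw [norm_add_sq_real, hk, hl, hj]; push_cast; ring⟩
  | smul r x _ h =>
    obtain ⟨k, hk⟩ := h
    refine ⟨r ^ 2 * k, ?_⟩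
    rw [← Int.cast_smul_eq_zsmul ℝ, norm_smul, mul_pow, hk, Real.norm_eq_abs, sq_abs]
    push_cast; ring

/-- In a root lattice the roots are the shortest vectors; two adjacent simple roots obstruct
refinability. -/
theorem not_isRefinable_of_gram {ι κ : Type} [Fintype ι] [Nonempty κ] {Λ : Submodule ℤ 𝔼}
    {G : Matrix ι ι ℤ} (hΛ : HasGramMatrix Λ G) (hdiag : ∀ i, G i i = 2) {i j : ι}
    (hij : G i j = -1) (s : κ → 𝔼) (m : ℕ) : ¬ IsRefinable (splineFamily Λ s m) := by
  obtain ⟨c, b, hc, rfl, hG⟩ := hΛ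
  have hbmem : ∀ i, b i ∈ Submodule.span ℤ (Set.range b) := fun i =>
    Submodule.subset_span ⟨i, rfl⟩
  have hnorm : ∀ i, ‖b i‖ ^ 2 = 2 * c := fun i => by
    rw [← real_inner_self_eq_norm_sq, hG, hdiag]; push_cast; ring
  have hmin : ∀ z ∈ Submodule.span ℤ (Set.range b), z ≠ 0 →
      ∃ k : ℤ, 1 ≤ k ∧ ‖z‖ ^ 2 = 2 * c * k := by
    intro z hz hz0
    obtain ⟨k, hk⟩ := exists_norm_sq_eq_of_mem_span hG hdiag hz
    refine ⟨k, ?_, hk⟩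
    have : 0 < ‖z‖ ^ 2 := by have := norm_pos_iff.2 hz0; positivity
    rw [hk] at this
    have := pos_of_mul_pos_right this (by positivity)
    exact_mod_cast this
  have hgap : ∀ i, ∀ z ∈ Submodule.span ℤ (Set.range b), z ≠ 0 → z ≠ b i →
      inner ℝ (b i) z + c ≤ ‖z‖ ^ 2 := by
    intro i z hz hz0 hzb
    obtain ⟨k, hk1, hk⟩ := hmin z hz hz0
    obtain ⟨l, hl1, hl⟩ := hmin (z - b i) (Submodule.sub_mem _ hz (hbmem i)) (sub_ne_zero.2 hzb)
    rw [norm_sub_sq_real, hnorm, hk, real_inner_comm] at hl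
    have hk1' : (1 : ℝ) ≤ k := by exact_mod_cast hk1
    have hl1' : (1 : ℝ) ≤ l := by exact_mod_cast hl1
    rw [hk]
    nlinarith
  refine not_isRefinable_of_relevant (isBounded_voronoiCell b hbmem) (v := b i) (y := -b j) (γ := c)
    (hbmem i) (Submodule.neg_mem _ (hbmem j)) hc (hgap i) ?_ ?_ ?_ s m
  · intro z hz
    by_cases h0 : z = 0
    · simp [h0]
    by_cases h1 : -z = b j
    · rw [inner_neg_left, ← inner_neg_right, h1, ← norm_neg z, h1, real_inner_self_eq_norm_sq]
    · have := hgap j (-z) (Submodule.neg_mem _ hz) (neg_ne_zero.2 h0) h1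
      rw [norm_neg, inner_neg_right, ← inner_neg_left] at this
      linarith
  · rw [inner_neg_right, hG, hij]; push_cast; linarith
  · rw [inner_neg_right, hG, hij, hnorm]; push_cast; linarith

/-! ### Dual lattices in coordinates -/

theorem exists_int_of_mem_dualLattice {Λ : Submodule ℤ 𝔼} {x z : 𝔼} (hx : x ∈ Λ)
    (hz : z ∈ dualLattice Λ) : ∃ k : ℤ, inner ℝ x z = k := by
  have h : inner ℝ z x ∈ (1 : Submodule ℤ ℝ) := hz x hx
  obtain ⟨k, hk⟩ := Submodule.mem_one.1 h
  exact ⟨k, by rw [real_inner_comm, ← hk]; simp⟩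

theorem mem_dualLattice_span {ι : Type} {b : ι → 𝔼} {z : 𝔼}
    (hz : ∀ i, ∃ k : ℤ, inner ℝ (b i) z = k) :
    z ∈ dualLattice (Submodule.span ℤ (Set.range b)) := by
  intro x hx
  change inner ℝ z x ∈ (1 : Submodule ℤ ℝ)
  induction hx using Submodule.span_induction with
  | mem x hx =>
    obtain ⟨i, rfl⟩ := hx
    obtain ⟨k, hk⟩ := hz i
    exact Submodule.mem_one.2 ⟨k, by rw [real_inner_comm, hk]; simp⟩
  | zero => rw [inner_zero_right]; exact Submodule.zero_mem _
  | add x y _ _ hx hy => rw [inner_add_right]; exact Submodule.add_mem _ hx hy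
  | smul r x _ h =>
    rw [← Int.cast_smul_eq_zsmul ℝ, real_inner_smul_right, ← zsmul_eq_mul]
    exact Submodule.smul_mem _ r h

theorem isBounded_voronoiCell_dualLattice {ι : Type} [Fintype ι] (b : Module.Basis ι ℝ 𝔼) :
    Bornology.IsBounded (voronoiCell (dualLattice (Submodule.span ℤ (Set.range b)))) := by
  classical
  let e : 𝔼 ≃ₗ[ℝ] (ι → ℝ) := LinearEquiv.ofBijective (innerCoords b)
    ⟨innerCoords_injective b, innerCoords_surjective b⟩
  refine isBounded_voronoiCell ((Pi.basisFun ℝ ι).map e.symm) fun i =>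
    mem_dualLattice_span fun j => ?_
  have h : innerCoords b (e.symm (Pi.single i 1)) = Pi.single i 1 := e.apply_symm_apply _
  have h' := congrFun h j
  rw [innerCoords_apply] at h'
  rw [Module.Basis.map_apply, Pi.basisFun_apply, h', Pi.single_apply]
  split_ifs
  · exact ⟨1, by simp⟩
  · exact ⟨0, by simp⟩

/-- A realization of a Gram matrix by vectors of a coordinate space extends to a linear map that
multiplies inner products by a constant. -/
theorem inner_eq_dotProduct_constr {ι κ : Type} [Fintype κ] {b : Module.Basis ι ℝ 𝔼}
    {e : ι → κ → ℝ} {c : ℝ} (h : ∀ i j, inner ℝ (b i) (b j) = c * e i ⬝ᵥ e j) (x z : 𝔼) :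
    inner ℝ x z = c * b.constr ℝ e x ⬝ᵥ b.constr ℝ e z := by
  let B₁ : 𝔼 →ₗ[ℝ] 𝔼 →ₗ[ℝ] ℝ := innerₗ 𝔼
  let B₂ : 𝔼 →ₗ[ℝ] 𝔼 →ₗ[ℝ] ℝ :=
    c • (dotProductBilin ℝ ℝ).compl₁₂ (b.constr ℝ e) (b.constr ℝ e)
  have hB : B₁ = B₂ := by
    refine b.ext fun i => b.ext fun j => ?_
    simp only [B₁, B₂, innerₗ_apply_apply, LinearMap.smul_apply, LinearMap.compl₁₂_apply,
      Module.Basis.constr_basis, smul_eq_mul]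
    exact h i j
  exact LinearMap.congr_fun₂ hB x z

/-! ### The dual of the lattice of type A -/

/-- The simple roots `eᵢ - eᵢ₊₁` of type `Aₙ` in `ℝⁿ⁺¹`. -/
def simpleRootA (n : ℕ) (i : Fin n) : Fin (n + 1) → ℝ :=
  Pi.single i.castSucc 1 - Pi.single i.succ 1

theorem simpleRootA_dotProduct (i : Fin n) (x : Fin (n + 1) → ℝ) :
    simpleRootA n i ⬝ᵥ x = x i.castSucc - x i.succ := by
  simp [simpleRootA, sub_dotProduct]

theorem simpleRootA_gram (i j : Fin n) :
    simpleRootA n i ⬝ᵥ simpleRootA n j = (CartanMatrix.A n i j : ℝ) := by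
  rw [simpleRootA_dotProduct]
  simp only [simpleRootA, Pi.sub_apply, Pi.single_apply, CartanMatrix.A, Matrix.of_apply,
    Fin.ext_iff, Fin.val_castSucc, Fin.val_succ]
  push_cast
  split_ifs <;> first | omega | norm_num

/-- Sums of products of differences, for the evaluation of Selling's form. -/
theorem sum_sum_sub_mul_sub (D E : Fin (n + 1) → ℝ) :
    ∑ i, ∑ j, (D i - D j) * (E i - E j) =
      2 * ((n + 1) * ∑ i, D i * E i - (∑ i, D i) * ∑ i, E i) := by
  have h : ∀ i j, (D i - D j) * (E i - E j) = D i * E i + D j * E j - D i * E j - E i * D j := by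
    intro i j; ring
  have hrow : ∀ i, ∑ j, (D i - D j) * (E i - E j) =
      (n + 1) * (D i * E i) + ∑ j, D j * E j - D i * ∑ j, E j - E i * ∑ j, D j := by
    intro i
    simp only [h, Finset.sum_sub_distrib, Finset.sum_add_distrib, ← Finset.mul_sum,
      Finset.sum_const, Finset.card_univ, Fintype.card_fin, nsmul_eq_mul]
    push_cast
    ring
  simp only [hrow, Finset.sum_sub_distrib, Finset.sum_add_distrib]
  rw [← Finset.mul_sum, ← Finset.sum_mul, ← Finset.sum_mul, Finset.sum_const, Finset.card_univ,
    Fintype.card_fin, nsmul_eq_mul]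
  push_cast
  ring

theorem sum_constr_simpleRootA (b : Module.Basis (Fin n) ℝ 𝔼) (x : 𝔼) :
    ∑ i, b.constr ℝ (simpleRootA n) x i = 0 := by
  let S : 𝔼 →ₗ[ℝ] ℝ := (dotProductBilin ℝ ℝ (1 : Fin (n + 1) → ℝ)).comp (b.constr ℝ (simpleRootA n))
  have hS : S = 0 := b.ext fun i => by
    simp [S, dotProductBilin, simpleRootA, dotProduct_sub]
  have := LinearMap.congr_fun hS x
  simpa [S, dotProductBilin, one_dotProduct] using this

/-- `D` is a height function of `x` when its successive differences are the inner products of `x`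
with the simple roots of type `A`. -/
def IsHeight {n : ℕ} (b : Module.Basis (Fin n) ℝ (EuclideanSpace ℝ (Fin n)))
    (x : EuclideanSpace ℝ (Fin n)) (D : Fin (n + 1) → ℝ) : Prop :=
  ∀ k : Fin n, inner ℝ (b k) x = D k.castSucc - D k.succ

/-- Selling's formula: inner products in terms of the differences of heights. -/
theorem inner_eq_sum_heights {b : Module.Basis (Fin n) ℝ 𝔼} {c : ℝ}
    (hG : ∀ i j, inner ℝ (b i) (b j) = c * (CartanMatrix.A n i j : ℝ)) {x z : 𝔼}
    {D E : Fin (n + 1) → ℝ} (hx : IsHeight b x D) (hz : IsHeight b z E) :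
    2 * (n + 1) * c * inner ℝ x z = ∑ i, ∑ j, (D i - D j) * (E i - E j) := by
  have hY := inner_eq_dotProduct_constr (e := simpleRootA n) (c := c)
    (fun i j => by rw [hG, simpleRootA_gram])
  have hdiff : ∀ {x : 𝔼} {D : Fin (n + 1) → ℝ}, IsHeight b x D → ∀ i,
      D i - c * b.constr ℝ (simpleRootA n) x i = D 0 - c * b.constr ℝ (simpleRootA n) x 0 := by
    intro x D hx i
    induction i using Fin.induction with
    | zero => rfl
    | succ k ih =>
      have h1 := hx k
      rw [hY, Module.Basis.constr_basis, simpleRootA_dotProduct] at h1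
      linarith
  have hD : ∀ i j, D i - D j =
      c * b.constr ℝ (simpleRootA n) x i - c * b.constr ℝ (simpleRootA n) x j := fun i j => by
    linarith [hdiff hx i, hdiff hx j]
  have hE : ∀ i j, E i - E j =
      c * b.constr ℝ (simpleRootA n) z i - c * b.constr ℝ (simpleRootA n) z j := fun i j => by
    linarith [hdiff hz i, hdiff hz j]
  simp only [hD, hE]
  rw [sum_sum_sub_mul_sub, hY, dotProduct]
  simp only [← Finset.mul_sum, sum_constr_simpleRootA]
  rw [show ∑ i, c * b.constr ℝ (simpleRootA n) x i * (c * b.constr ℝ (simpleRootA n) z i) =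
    c * c * ∑ i, b.constr ℝ (simpleRootA n) x i * b.constr ℝ (simpleRootA n) z i by
      rw [Finset.mul_sum]; exact Finset.sum_congr rfl fun i _ => by ring]
  ring

theorem exists_int_height {b : Module.Basis (Fin n) ℝ 𝔼} {z : 𝔼}
    (hz : z ∈ dualLattice (Submodule.span ℤ (Set.range b))) :
    ∃ N : Fin (n + 1) → ℤ, IsHeight b z fun i => (N i : ℝ) := by
  choose a ha using fun k : Fin n =>
    exists_int_of_mem_dualLattice
      (Submodule.subset_span ⟨k, rfl⟩ : b k ∈ Submodule.span ℤ (Set.range b)) hz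
  refine ⟨fun i => Fin.induction (motive := fun _ => ℤ) 0 (fun k r => r - a k) i, fun k => ?_⟩
  simp only [ha, Fin.induction_succ]
  push_cast
  ring

theorem exists_isHeight (b : Module.Basis (Fin n) ℝ 𝔼) (N : Fin (n + 1) → ℤ) :
    ∃ x ∈ dualLattice (Submodule.span ℤ (Set.range b)), IsHeight b x fun i => (N i : ℝ) := by
  obtain ⟨x, hx⟩ := innerCoords_surjective b fun k => (N k.castSucc : ℝ) - N k.succ
  have hx' : ∀ k, inner ℝ (b k) x = (N k.castSucc : ℝ) - N k.succ := fun k => congrFun hx k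
  refine ⟨x, mem_dualLattice_span fun k => ⟨N k.castSucc - N k.succ, ?_⟩, hx'⟩
  rw [hx']
  push_cast
  rfl

/-- An integer dominates, in square, its product with any of `-1`, `0`, `1`. -/
theorem int_mul_le_mul_self {ε k : ℤ} (h1 : -1 ≤ ε) (h2 : ε ≤ 1) : ε * k ≤ k * k := by
  obtain rfl | rfl | rfl : ε = -1 ∨ ε = 0 ∨ ε = 1 := by omega
  · rcases le_or_gt 0 k with h | h <;> nlinarith
  · nlinarith
  · rcases le_or_gt k 0 with h | h <;> nlinarith

/-- In the lattice dual to type `A`, the vectors with heights `(1, 0, …, 0)` and `(0, -1, 0, …, 0)`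
obstruct refinability: Selling's formula reduces the required inequalities to `k ≤ k²` for
integers. -/
theorem not_isRefinable_dual_A {κ : Type} [Nonempty κ] (hn : 2 ≤ n) {Λ₀ : Submodule ℤ 𝔼}
    (hΛ : HasGramMatrix Λ₀ (CartanMatrix.A n)) (s : κ → 𝔼) (m : ℕ) :
    ¬ IsRefinable (splineFamily (dualLattice Λ₀) s m) := by
  obtain ⟨c, b, hc, rfl, hG⟩ := hΛ
  set K : ℝ := 2 * (n + 1) * c with hK
  have hKpos : 0 < K := by positivity
  let i₀ : Fin (n + 1) := ⟨0, by omega⟩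
  let i₁ : Fin (n + 1) := ⟨1, by omega⟩
  have h01 : i₀ ≠ i₁ := by simp [i₀, i₁]
  let χ : Fin (n + 1) → ℤ := Pi.single i₀ 1
  let χ' : Fin (n + 1) → ℤ := -Pi.single i₁ 1
  obtain ⟨v, hv, hvD⟩ := exists_isHeight b χ
  obtain ⟨y, hy, hyD⟩ := exists_isHeight b χ'
  have hχ : ∀ i j, -1 ≤ χ i - χ j ∧ χ i - χ j ≤ 1 := by
    intro i j
    simp only [χ, Pi.single_apply]
    split_ifs <;> norm_num
  have hχ' : ∀ i j, -1 ≤ χ' i - χ' j ∧ χ' i - χ' j ≤ 1 := by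
    intro i j
    simp only [χ', Pi.neg_apply, Pi.single_apply]
    split_ifs <;> norm_num
  have hform := fun {x z : 𝔼} {D E : Fin (n + 1) → ℝ} (hx : IsHeight b x D) (hz : IsHeight b z E) =>
    inner_eq_sum_heights hG hx hz
  have hvy : K * inner ℝ v y = 2 := by
    rw [hform hvD hyD, sum_sum_sub_mul_sub]
    simp [χ, χ', Pi.single_apply, h01.symm]
  have hvv : K * ‖v‖ ^ 2 = 2 * n := by
    rw [← real_inner_self_eq_norm_sq, hform hvD hvD, sum_sum_sub_mul_sub]
    simp [χ, Pi.single_apply]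
  have hn' : (2 : ℝ) ≤ n := by exact_mod_cast hn
  refine not_isRefinable_of_relevant (isBounded_voronoiCell_dualLattice b) hv hy
    (inv_pos.2 hKpos) ?_ ?_ ?_ ?_ s m
  · intro z hz hz0 hzv
    obtain ⟨N, hN⟩ := exists_int_height hz
    have hvz : K * inner ℝ v z = ∑ i, ∑ j, (((χ i - χ j) * (N i - N j) : ℤ) : ℝ) := by
      rw [hform hvD hN]; push_cast; rfl
    have hzz : K * ‖z‖ ^ 2 = ∑ i, ∑ j, (((N i - N j) * (N i - N j) : ℤ) : ℝ) := by
      rw [← real_inner_self_eq_norm_sq, hform hN hN]; push_cast; rfl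
    have hterm : ∀ i j, (χ i - χ j) * (N i - N j) ≤ (N i - N j) * (N i - N j) := fun i j =>
      int_mul_le_mul_self (hχ i j).1 (hχ i j).2
    have hle : ∑ i, ∑ j, (χ i - χ j) * (N i - N j) ≤ ∑ i, ∑ j, (N i - N j) * (N i - N j) :=
      Finset.sum_le_sum fun i _ => Finset.sum_le_sum fun j _ => hterm i j
    have hlt : ∑ i, ∑ j, (χ i - χ j) * (N i - N j) < ∑ i, ∑ j, (N i - N j) * (N i - N j) := by
      refine lt_of_le_of_ne hle fun heq => ?_
      -- In the equality case all terms agree, which leaves only `z = 0` and `z = v`.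
      have h1 := (Finset.sum_eq_sum_iff_of_le fun i _ =>
        Finset.sum_le_sum fun j _ => hterm i j).1 heq
      have h2 : ∀ i j, (χ i - χ j) * (N i - N j) = (N i - N j) * (N i - N j) := fun i j =>
        (Finset.sum_eq_sum_iff_of_le fun j _ => hterm i j).1 (h1 i (Finset.mem_univ _)) j
          (Finset.mem_univ _)
      have h3 : ∀ j, j ≠ i₀ → N j = N i₁ := by
        intro j hj
        have := h2 j i₁
        simp only [χ, Pi.single_apply, hj, h01.symm, if_false, sub_zero, zero_mul] at this
        have := mul_self_eq_zero.1 this.symm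
        omega
      have h4 : N i₀ - N i₁ = 0 ∨ N i₀ - N i₁ = 1 := by
        have := h2 i₀ i₁
        simp only [χ, Pi.single_apply, h01.symm, if_false, if_true, sub_zero, one_mul] at this
        by_cases h : N i₀ - N i₁ = 0
        · exact Or.inl h
        · exact Or.inr (mul_right_cancel₀ h (by rw [one_mul]; exact this.symm))
      rcases h4 with h4 | h4
      · have h5 : ∀ i, N i = N i₁ := fun i => by
          by_cases h : i = i₀
          · rw [h]; omega
          · exact h3 i h
        have : K * ‖z‖ ^ 2 = 0 := by rw [hzz]; simp [h5]
        exact hz0 (norm_eq_zero.1 (pow_eq_zero_iff two_ne_zero |>.1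
          ((mul_eq_zero.1 this).resolve_left hKpos.ne')))
      · refine hzv (innerCoords_injective b (funext fun k => ?_))
        have h5 : ∀ i, N i = N i₁ + χ i := fun i => by
          by_cases h : i = i₀
          · rw [h]; simp only [χ, Pi.single_eq_same]; omega
          · rw [h3 i h]; simp [χ, h]
        rw [innerCoords_apply, innerCoords_apply, hN k, hvD k]
        beta_reduce
        rw [h5, h5 k.succ]
        push_cast
        ring
    have hlt' : (∑ i, ∑ j, (((χ i - χ j) * (N i - N j) : ℤ) : ℝ)) + 1 ≤
        ∑ i, ∑ j, (((N i - N j) * (N i - N j) : ℤ) : ℝ) := by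
      exact_mod_cast hlt
    rw [← hvz, ← hzz] at hlt'
    refine le_of_mul_le_mul_left ?_ hKpos
    rw [mul_add, mul_inv_cancel₀ hKpos.ne']
    exact hlt'
  · intro z hz
    obtain ⟨N, hN⟩ := exists_int_height hz
    refine le_of_mul_le_mul_left ?_ hKpos
    rw [← real_inner_self_eq_norm_sq, hform hyD hN, hform hN hN]
    refine Finset.sum_le_sum fun i _ => Finset.sum_le_sum fun j _ => ?_
    exact_mod_cast int_mul_le_mul_self (k := N i - N j) (hχ' i j).1 (hχ' i j).2
  · exact pos_of_mul_pos_right (by rw [hvy]; norm_num) hKpos.le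
  · refine lt_of_mul_lt_mul_left ?_ hKpos.le
    rw [hvy, hvv]
    linarith

/-! ### The dual of the lattice of type D -/

/-- The simple roots of type `D` in rank `r + 2`: the vectors `eᵢ - eᵢ₊₁` and, last, the sum of the
last two unit vectors. -/
def simpleRootD (r : ℕ) : Fin (r + 2) → Fin (r + 2) → ℝ :=
  Fin.lastCases (Pi.single (Fin.last r).castSucc 1 + Pi.single (Fin.last (r + 1)) 1)
    fun i : Fin (r + 1) => Pi.single i.castSucc 1 - Pi.single i.succ 1

theorem simpleRootD_castSucc_dotProduct {r : ℕ} (i : Fin (r + 1)) (x : Fin (r + 2) → ℝ) :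
    simpleRootD r i.castSucc ⬝ᵥ x = x i.castSucc - x i.succ := by
  simp [simpleRootD, sub_dotProduct]

theorem simpleRootD_last_dotProduct {r : ℕ} (x : Fin (r + 2) → ℝ) :
    simpleRootD r (Fin.last (r + 1)) ⬝ᵥ x = x (Fin.last r).castSucc + x (Fin.last (r + 1)) := by
  simp [simpleRootD, add_dotProduct]

theorem simpleRootD_gram {r : ℕ} (hr : 1 ≤ r) (i j : Fin (r + 2)) :
    simpleRootD r i ⬝ᵥ simpleRootD r j = (CartanMatrix.D (r + 2) i j : ℝ) := by
  induction i using Fin.lastCases with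
  | last =>
    rw [simpleRootD_last_dotProduct]
    induction j using Fin.lastCases with
    | last =>
      simp [simpleRootD, CartanMatrix.D, Fin.ext_iff]
      norm_num
    | cast j =>
      have hj := j.isLt
      simp only [simpleRootD, Fin.lastCases_castSucc, Pi.sub_apply, Pi.single_apply,
        CartanMatrix.D, Matrix.of_apply, Fin.ext_iff, Fin.val_castSucc, Fin.val_succ, Fin.val_last,
        or_true, and_true]
      push_cast
      split_ifs <;> first | omega | norm_num
  | cast i =>
    have hi := i.isLt
    rw [simpleRootD_castSucc_dotProduct]
    induction j using Fin.lastCases with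
    | last =>
      simp only [simpleRootD, Fin.lastCases_last, Pi.add_apply, Pi.single_apply,
        CartanMatrix.D, Matrix.of_apply, Fin.ext_iff, Fin.val_castSucc, Fin.val_succ, Fin.val_last,
        or_true, and_true]
      push_cast
      split_ifs <;> first | omega | norm_num
    | cast j =>
      have hj := j.isLt
      simp only [simpleRootD, Fin.lastCases_castSucc, Pi.sub_apply, Pi.single_apply,
        CartanMatrix.D, Matrix.of_apply, Fin.ext_iff, Fin.val_castSucc, Fin.val_succ]
      push_cast
      split_ifs <;> first | omega | norm_num

/-- In the lattice dual to type `D`, generated by the standard lattice and the vector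
`(1/2, …, 1/2)`, that vector and a unit vector obstruct refinability. -/
theorem not_isRefinable_dual_D {κ : Type} [Nonempty κ] (hn : 3 ≤ n) {Λ₀ : Submodule ℤ 𝔼}
    (hΛ : HasGramMatrix Λ₀ (CartanMatrix.D n)) (s : κ → 𝔼) (m : ℕ) :
    ¬ IsRefinable (splineFamily (dualLattice Λ₀) s m) := by
  obtain ⟨r, rfl⟩ : ∃ r, n = r + 2 := ⟨n - 2, by omega⟩
  obtain ⟨c, b, hc, rfl, hG⟩ := hΛ
  set Y := b.constr ℝ (simpleRootD r) with hYdef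
  have hY : ∀ x z, inner ℝ x z = c * Y x ⬝ᵥ Y z := inner_eq_dotProduct_constr
    (fun i j => by rw [hG, simpleRootD_gram (by omega)])
  have hYb : ∀ k x, inner ℝ (b k) x = c * simpleRootD r k ⬝ᵥ Y x := fun k x => by
    rw [hY, hYdef, Module.Basis.constr_basis]
  have hYinj : Function.Injective Y := by
    rw [injective_iff_map_eq_zero]
    intro x hx
    have := hY x x
    rwa [hx, dotProduct_zero, mul_zero, inner_self_eq_zero] at this
  have hYsurj : Function.Surjective Y :=
    (LinearMap.injective_iff_surjective_of_finrank_eq_finrank (by simp)).1 hYinj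
  -- Doubled coordinates are integers, of the same parity.
  have hint : ∀ z ∈ dualLattice (Submodule.span ℤ (Set.range b)),
      ∃ (p : ℤ) (N : Fin (r + 2) → ℤ), ∀ i, 2 * c * Y z i = ((p + 2 * N i : ℤ) : ℝ) := by
    intro z hz
    choose a ha using fun k : Fin (r + 2) =>
      exists_int_of_mem_dualLattice
        (Submodule.subset_span ⟨k, rfl⟩ : b k ∈ Submodule.span ℤ (Set.range b)) hz
    have hlast : 2 * c * Y z (Fin.last (r + 1)) =
        ((a (Fin.last (r + 1)) - a (Fin.last r).castSucc : ℤ) : ℝ) := by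
      push_cast
      rw [← ha, ← ha, hYb, hYb, simpleRootD_last_dotProduct, simpleRootD_castSucc_dotProduct,
        Fin.succ_last]
      ring
    refine ⟨a (Fin.last (r + 1)) - a (Fin.last r).castSucc,
      fun i => Fin.reverseInduction (motive := fun _ => ℤ) 0 (fun k t => t + a k.castSucc) i,
      fun i => ?_⟩
    induction i using Fin.reverseInduction with
    | last => rw [hlast]; simp
    | cast k ih =>
      simp only [Fin.reverseInduction_castSucc]
      have h1 := ha k.castSucc
      rw [hYb, simpleRootD_castSucc_dotProduct] at h1
      push_cast at ih ⊢
      linarith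
  have hmem : ∀ (x : EuclideanSpace ℝ (Fin (r + 2))) (p : ℤ) (N : Fin (r + 2) → ℤ),
      (∀ i, 2 * c * Y x i = ((p + 2 * N i : ℤ) : ℝ)) →
      x ∈ dualLattice (Submodule.span ℤ (Set.range b)) := by
    intro x p N hx
    refine mem_dualLattice_span fun k => ?_
    rw [hYb]
    induction k using Fin.lastCases with
    | last =>
      refine ⟨p + N (Fin.last r).castSucc + N (Fin.last (r + 1)), ?_⟩
      rw [simpleRootD_last_dotProduct]
      have h1 := hx (Fin.last r).castSucc
      have h2 := hx (Fin.last (r + 1))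
      push_cast at h1 h2 ⊢
      linarith
    | cast k =>
      refine ⟨N k.castSucc - N k.succ, ?_⟩
      rw [simpleRootD_castSucc_dotProduct]
      have h1 := hx k.castSucc
      have h2 := hx k.succ
      push_cast at h1 h2 ⊢
      linarith
  obtain ⟨v, hv⟩ := hYsurj fun _ => (2 * c)⁻¹
  obtain ⟨y, hy⟩ := hYsurj (Pi.single 0 c⁻¹)
  have hvΛ : v ∈ dualLattice (Submodule.span ℤ (Set.range b)) := hmem v 1 0 fun i => by
    rw [hv, mul_inv_cancel₀ (by positivity)]; simp
  have hyΛ : y ∈ dualLattice (Submodule.span ℤ (Set.range b)) :=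
    hmem y 0 (Pi.single 0 1) fun i => by
    rw [hy]
    by_cases hi : i = 0
    · subst hi
      simp only [Pi.single_eq_same]
      rw [mul_inv_cancel_right₀ hc.ne']; norm_num
    · simp [hi]
  have hK : 0 < 4 * c := by positivity
  have hvz : ∀ z, 4 * c * inner ℝ v z = ∑ i, 2 * c * Y z i := by
    intro z
    rw [hY, hv, dotProduct, ← Finset.mul_sum, ← Finset.mul_sum]
    field_simp
    norm_num
  have hyz : ∀ z, 4 * c * inner ℝ y z = 2 * (2 * c * Y z 0) := by
    intro z
    rw [hY, hy, single_dotProduct]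
    field_simp
    ring
  have hzz : ∀ z, 4 * c * ‖z‖ ^ 2 = ∑ i, (2 * c * Y z i) * (2 * c * Y z i) := by
    intro z
    rw [← real_inner_self_eq_norm_sq, hY, dotProduct, Finset.mul_sum, Finset.mul_sum]
    exact Finset.sum_congr rfl fun i _ => by ring
  refine not_isRefinable_of_relevant (isBounded_voronoiCell_dualLattice b) hvΛ hyΛ
    (inv_pos.2 hK) ?_ ?_ ?_ ?_ s m
  · intro z hz hz0 hzv
    obtain ⟨p, N, hN⟩ := hint z hz
    refine le_of_mul_le_mul_left ?_ hK
    rw [mul_add, mul_inv_cancel₀ hK.ne', hvz, hzz]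
    simp only [hN]
    norm_cast
    have hterm : ∀ i, p + 2 * N i ≤ (p + 2 * N i) * (p + 2 * N i) := fun i => by
      have := int_mul_le_mul_self (ε := 1) (k := p + 2 * N i) (by norm_num) le_rfl
      linarith
    refine Int.add_one_le_iff.2
      (lt_of_le_of_ne (Finset.sum_le_sum fun i _ => hterm i) fun heq => ?_)
    have h1 : ∀ i, p + 2 * N i = 0 ∨ p + 2 * N i = 1 := fun i => by
      have h2 := (Finset.sum_eq_sum_iff_of_le fun i _ => hterm i).1 heq i (Finset.mem_univ _)
      by_cases h : p + 2 * N i = 0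
      · exact Or.inl h
      · exact Or.inr (mul_right_cancel₀ h (by rw [one_mul]; exact h2.symm))
    -- Equal parities leave only the vectors with all coordinates `0` or all coordinates `1/2`.
    have h2 : ∀ i, p + 2 * N i = p + 2 * N 0 := fun i => by
      have := h1 i; have := h1 0; omega
    have h2c : 2 * c ≠ 0 := by positivity
    rcases h1 0 with h0 | h0
    · refine hz0 (hYinj (funext fun i => ?_))
      have := hN i
      rw [h2, h0] at this
      simpa [h2c, hc.ne'] using this
    · refine hzv (hYinj (funext fun i => ?_))
      have := hN i
      rw [h2, h0] at this
      rw [hv]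
      push_cast at this
      field_simp
      linarith
  · intro z hz
    obtain ⟨p, N, hN⟩ := hint z hz
    refine le_of_mul_le_mul_left ?_ hK
    rw [hyz, hzz]
    simp only [hN]
    norm_cast
    have hl : Fin.last (r + 1) ≠ 0 := by simp [Fin.ext_iff]
    have h1 : (p + 2 * N 0) * (p + 2 * N 0) +
        (p + 2 * N (Fin.last (r + 1))) * (p + 2 * N (Fin.last (r + 1))) ≤
          ∑ i, (p + 2 * N i) * (p + 2 * N i) := by
      rw [← Finset.sum_pair hl.symm (f := fun i => (p + 2 * N i) * (p + 2 * N i))]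
      exact Finset.sum_le_sum_of_subset_of_nonneg (Finset.subset_univ _)
        fun i _ _ => mul_self_nonneg _
    refine le_trans ?_ h1
    -- `2 k ≤ k²` fails only for `k = 1`; then all doubled coordinates are odd.
    by_cases h : p + 2 * N 0 = 1
    · have h3 : p + 2 * N (Fin.last (r + 1)) ≠ 0 := by omega
      have := mul_self_pos.2 h3
      rw [h]
      linarith
    · have h3 : 0 ≤ (p + 2 * N 0) * (p + 2 * N 0 - 2) := by
        rcases le_or_gt (p + 2 * N 0) 0 with h4 | h4
        · exact mul_nonneg_of_nonpos_of_nonpos h4 (by omega)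
        · exact mul_nonneg h4.le (by omega)
      have := mul_self_nonneg (p + 2 * N (Fin.last (r + 1)))
      linarith
  · refine pos_of_mul_pos_right (a := 4 * c) ?_ hK.le
    rw [real_inner_comm, hyz, hv, mul_inv_cancel₀ (by positivity)]
    norm_num
  · refine lt_of_mul_lt_mul_left (a := 4 * c) ?_ hK.le
    rw [real_inner_comm, hyz, hzz, hv]
    simp only [mul_inv_cancel₀ (by positivity : 2 * c ≠ 0)]
    have : (3 : ℝ) ≤ r + 2 := by exact_mod_cast hn
    simp
    linarith

end VoronoiSpline

theorem mainTheorem8 {n : ℕ} (Λ : Submodule ℤ (EuclideanSpace ℝ (Fin n)))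
    (hΛ : VoronoiSpline.IsNonCartesianRootLattice Λ)
    (J : ℕ) (s : Fin (J + 1) → EuclideanSpace ℝ (Fin n))
    (hdistinct : Function.Injective fun j => VoronoiSpline.tessellation Λ (s j))
    (hefficient : VoronoiSpline.IsEfficient fun j => VoronoiSpline.tessellation Λ (s j))
    (m : ℕ) :
    ¬ VoronoiSpline.IsRefinable (VoronoiSpline.splineFamily Λ s m) := by
  rcases hΛ with ⟨hn, h⟩ | ⟨hn, Λ₀, h, rfl⟩ | ⟨hn, h⟩ | ⟨hn, Λ₀, h, rfl⟩ | h | h | h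
  · exact VoronoiSpline.not_isRefinable_of_gram h (fun i => by simp [CartanMatrix.A])
      (i := ⟨0, by omega⟩) (j := ⟨1, by omega⟩) (by simp [CartanMatrix.A]) s m
  · exact VoronoiSpline.not_isRefinable_dual_A hn h s m
  · refine VoronoiSpline.not_isRefinable_of_gram h (CartanMatrix.D_diag n)
      (i := ⟨n - 3, by omega⟩) (j := ⟨n - 2, by omega⟩) ?_ s m
    simp only [CartanMatrix.D, Matrix.of_apply, Fin.ext_iff]
    split_ifs <;> omega
  · exact VoronoiSpline.not_isRefinable_dual_D hn h s m
  · exact VoronoiSpline.not_isRefinable_of_gram h CartanMatrix.E₆_diag (i := 0) (j := 2)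
      (by decide) s m
  · exact VoronoiSpline.not_isRefinable_of_gram h CartanMatrix.E₇_diag (i := 0) (j := 2)
      (by decide) s m
  · exact VoronoiSpline.not_isRefinable_of_gram h CartanMatrix.E₈_diag (i := 0) (j := 2)
      (by decide) s m
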